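/- \textbf{Setting.} Let $p$ be a prime, $|\cdot|$ the absolute value of $\mathbb{C}_p$ with $|p|=1/p$, and $\varrho=p^{-1/(p-1)}$. The Berkovich affine line $\mathbb{A}^1_{an}$ is the set of multiplicative seminorms on $\mathbb{C}_p[z]$ extending $|\cdot|$; $\mathcal{D}(a,r)\subset\mathbb{A}^1_{an}$ is the open disk $\{x : |z-a|_x<r\}$. For a strictly increasing sequence $\mathbf{r}=(R_j)_{j\ge1}$ of reals with $R_1>p$ and $R_j\to\infty$, let $\mathcal{C}(\mathbf{r})$ be the set of sequences $\mathbf{c}=(c_j)_{j\ge1}$ in $\mathbb{C}_p$ with $|c_j|=R_j$ for all $j$. For $\mathbf{c}\in\mathcal{C}(\mathbf{r})$ let $$f_{\mathbf{c}}(z)=\frac{z^p}{p}\prod_{j\ge1}\Big(1-\frac{z}{c_j}\Big),$$ an entire function, and denote also by $f_{\mathbf{c}}$ its action on $\mathbb{A}^1_{an}$. Put $\varphi(t)=\sup\{|f_{\mathbf{c}}(z)| : |z|\le t\}$, an increasing bijection of $]0,\infty[$ that depends only on $\mathbf{r}$, and $S_j=\varphi^{-1}(R_j)$. The sequence $\mathbf{r}$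 is \emph{generic} if moreover $\varphi^{\circ n}(R_i)\ne R_j$ for all $j>i\ge1$ and $n\ge1$. Let $B_0=\mathcal{D}(0,1)$, $B_j=\mathcal{D}(c_j,R_j)$ for $j\ge1$, and $A=\mathbb{A}^1_{an}\setminus\bigcup_{j\ge0}B_j$. For $j\ge1$, let $\lambda_j$ be the multiplier of the unique fixed point of $f_{\mathbf{c}}$ in $B_j$, and let $n_j=\min\{n\ge1 : f_{\mathbf{c}}^{-(n+1)}(B_j)\cap B_0\neq\emptyset\}$; $|\lambda_j|$ and $n_j$ depend only on $\mathbf{r}$. For a finite word $\boldsymbol\alpha=\alpha_0\cdots\alpha_N$ in the letters $A,B_0,B_1,\dots$, the cylinder $C_{\mathbf{c}}(\boldsymbol\alpha)$ is the set of all $x\in\mathbb{A}^1_{an}$ with $f_{\mathbf{c}}^{\circ n}(x)\in\alpha_n$ for $0\le n\le N$, the letters being read with respect to $\mathbf{c}$. For sequences $\mathbf{m}=(m_j)_{j\ge1}$ and $\boldsymbol\ell=(\ell_j)_{j\ge2}$ of positive integers and $k\ge1$ let $$\boldsymbol\alpha^{(k)}=B_0^{m_1}A^{n_1}B_1^{\ell_2}B_0^{m_2}A^{n_2}B_2^{\ell_3}\cdots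 B_{k-1}^{\ell_k}B_0^{m_k}A^{n_k}B_k .$$ For $\mathbf{c}\in\mathcal{C}(\mathbf{r})$, a sequence $\boldsymbol\varepsilon=(\varepsilon_j)_{j\ge1}$ and $k\ge1$, let $\Delta_k(\mathbf{c},\boldsymbol\varepsilon)$ be the set of sequences $\mathbf{c}'=(c'_j)_{j\ge1}$ in $\mathbb{C}_p$ with $c'_j=c_j$ for $j<k$ and $|c_j-c'_j|<\varepsilon_j$ for $j\ge k$. \textbf{Lemma (Cylinder stability).} Let $\mathbf{r}=(R_j)$ be a generic sequence of radii, let $\mathbf{m}=(m_j)_{j\ge1}$ and $\boldsymbol\ell=(\ell_j)_{j\ge2}$ be sequences of positive integers, let $\boldsymbol\varepsilon=(\varepsilon_j)_{j\ge1}$ be real numbers with $0<\varepsilon_j<R_j$ for all $j$, and let $k_0\ge1$. Suppose that for all $k>k_0$ $$\varepsilon_k<\varrho^{\,k-j}\cdot\frac{R_k^2}{R_{j-1}S_{j-1}}\,|\lambda_{j-1}|^{-\ell_j}\qquad\text{for all }2\le j<k,$$ and that $$\varrho^{-2}R_{j-1}S_{j-1}|\lambda_{j-1}|^{\ell_j}p^{-m_j}<1\qquad\text{for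 all }2\le j\le k_0 .$$ If $\mathbf{c}\in\mathcal{C}(\mathbf{r})$, then for all $\mathbf{c}'\in\Delta_{k_0+1}(\mathbf{c},\boldsymbol\varepsilon)$, $$C_{\mathbf{c}'}(\boldsymbol\alpha^{(k_0)})=C_{\mathbf{c}}(\boldsymbol\alpha^{(k_0)}).$$ -/

import Mathlib

open Polynomial Filter Topology

noncomputable section

namespace CylStab

variable (p : ℕ) [hp : Fact p.Prime]

/-! ### The Berkovich affine line over `ℂ_p` -/

/-- Points of the Berkovich affine line: multiplicative seminorms on `ℂ_p[z]` that extend the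
`p`-adic absolute value. -/
structure BerkovichLine extends MulRingSeminorm ℂ_[p][X] where
  map_C' : ∀ a : ℂ_[p], toFun (C a) = ‖a‖

variable {p}

namespace BerkovichLine

instance : FunLike (BerkovichLine p) ℂ_[p][X] ℝ where
  coe x := x.toMulRingSeminorm
  coe_injective x y h := by
    cases x; cases y; congr
    exact DFunLike.coe_injective h

instance : MulRingSeminormClass (BerkovichLine p) ℂ_[p][X] ℝ where
  map_zero x := map_zero x.toMulRingSeminorm
  map_one x := map_one x.toMulRingSeminorm
  map_add_le_add x := map_add_le_add x.toMulRingSeminorm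
  map_mul x := map_mul x.toMulRingSeminorm
  map_neg_eq_map x := map_neg_eq_map x.toMulRingSeminorm

theorem map_C (x : BerkovichLine p) (a : ℂ_[p]) : x (C a) = ‖a‖ := x.map_C' a

theorem nonneg (x : BerkovichLine p) (g : ℂ_[p][X]) : 0 ≤ x g := apply_nonneg x g

/-- A multiplicative seminorm extending the `p`-adic absolute value is non-Archimedean. -/
theorem add_le_max (x : BerkovichLine p) (u v : ℂ_[p][X]) : x (u + v) ≤ max (x u) (x v) := by
  refine le_of_forall_gt_imp_ge_of_dense fun a ha => ?_
  have hM : 0 ≤ max (x u) (x v) := le_max_of_le_left (x.nonneg u)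
  set M := max (x u) (x v) with hMdef
  have ha0 : 0 < a := lt_of_le_of_lt hM ha
  have hnat : ∀ n : ℕ, x (n : ℂ_[p][X]) ≤ 1 := by
    intro n
    rw [← Polynomial.C_eq_natCast, map_C]
    exact IsUltrametricDist.norm_natCast_le_one _ n
  have hnat : ∀ n : ℕ, x (n : ℂ_[p][X]) ≤ 1 := by
    intro n
    rw [← Polynomial.C_eq_natCast, map_C]
    exact IsUltrametricDist.norm_natCast_le_one _ n
  have key : ∀ m : ℕ, x (u + v) ^ m ≤ (m + 1 : ℝ) * M ^ m := by
    intro m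
    rw [← map_pow, (Commute.all u v).add_pow]
    refine (Finset.le_sum_of_subadditive x (map_zero x).le (map_add_le_add x) _ _).trans ?_
    have : ∀ i ∈ Finset.range (m + 1), x (u ^ i * v ^ (m - i) * (m.choose i : ℂ_[p][X])) ≤ M ^ m := by
      intro i hi
      have him : i + (m - i) = m := by
        have := Finset.mem_range.1 hi
        omega
      calc x (u ^ i * v ^ (m - i) * (m.choose i : ℂ_[p][X]))
          = x u ^ i * x v ^ (m - i) * x (m.choose i : ℂ_[p][X]) := by
            rw [map_mul, map_mul, map_pow, map_pow]
        _ ≤ M ^ i * M ^ (m - i) * 1 := by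
            have h1 : x u ^ i ≤ M ^ i := pow_le_pow_left₀ (x.nonneg u) (le_max_left _ _) i
            have h2 : x v ^ (m - i) ≤ M ^ (m - i) :=
              pow_le_pow_left₀ (x.nonneg v) (le_max_right _ _) _
            have h3 := hnat (m.choose i)
            have h4 := x.nonneg (m.choose i : ℂ_[p][X])
            have h5 : 0 ≤ x v ^ (m - i) := pow_nonneg (x.nonneg v) _
            have h6 : 0 ≤ M ^ i := pow_nonneg hM _
            have h7 : 0 ≤ M ^ (m - i) := pow_nonneg hM _
            exact mul_le_mul (mul_le_mul h1 h2 h5 h6) h3 h4 (mul_nonneg h6 h7)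
        _ = M ^ m := by rw [mul_one, ← pow_add, him]
    refine (Finset.sum_le_sum this).trans ?_
    simp
  rcases hM.eq_or_lt with h0 | hpos
  · have h1 := key 1
    rw [← h0] at h1
    simp only [pow_one, mul_zero] at h1
    exact h1.trans ha0.le
  · obtain ⟨m, hm⟩ := Real.exists_natCast_add_one_lt_pow_of_one_lt ((one_lt_div hpos).2 ha)
    rw [div_pow, lt_div_iff₀ (pow_pos hpos m)] at hm
    refine le_of_pow_le_pow_left₀ (fun h => ?_) ha0.le ((key m).trans hm.le)
    subst h
    simp at hm

/-- The classical (type I) point of the Berkovich line given by `z ∈ ℂ_p`. -/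
def ofPoint (z : ℂ_[p]) : BerkovichLine p where
  toFun g := ‖g.eval z‖
  map_zero' := by simp
  map_one' := by simp
  map_mul' g h := by simp
  add_le' g h := by simpa using norm_add_le (g.eval z) (h.eval z)
  neg' g := by simp
  map_C' a := by simp

/-- The open Berkovich disk `𝒟(a, r)`. -/
def disk (a : ℂ_[p]) (r : ℝ) : Set (BerkovichLine p) := {x | x (X - C a) < r}

end BerkovichLine

/-! ### The maps `f_c` -/

variable (p) in
/-- Sequences `(c_j)_{j ≥ 1}` in `ℂ_p` with `|c_j| → ∞`. The term `c 0` plays no role. -/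
structure Param where
  toFun : ℕ → ℂ_[p]
  tendsto_norm : Tendsto (fun j => ‖toFun j‖) atTop atTop

instance : CoeFun (Param p) (fun _ => ℕ → ℂ_[p]) := ⟨Param.toFun⟩

/-- The entire function `f_c(z) = (z ^ p / p) ∏_{j ≥ 1} (1 - z / c_j)` on `ℂ_p`. -/
def entireMap (c : Param p) (z : ℂ_[p]) : ℂ_[p] :=
  z ^ p / (p : ℂ_[p]) * ∏' j : ℕ, (1 - z / c (j + 1))

/-- The partial products `(X ^ p / p) ∏_{1 ≤ j ≤ N} (1 - X / c_j)` of `f_c`. -/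
def partialProd (c : Param p) (N : ℕ) : ℂ_[p][X] :=
  C (p : ℂ_[p])⁻¹ * X ^ p * ∏ j ∈ Finset.range N, (1 - C (c (j + 1))⁻¹ * X)

theorem partialProd_succ (c : Param p) (N : ℕ) :
    partialProd c (N + 1) = partialProd c N * (1 - C (c (N + 1))⁻¹ * X) := by
  rw [partialProd, partialProd, Finset.prod_range_succ]
  ring

namespace BerkovichLine

theorem exists_bound_partialProd (c : Param p) (x : BerkovichLine p) :
    ∃ B : ℝ, ∀ N, x (partialProd c N) ≤ B := by
  obtain ⟨N₀, hN₀⟩ := eventually_atTop.1 (c.tendsto_norm.eventually_ge_atTop (max 1 (x X)))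
  have hstep : ∀ N ≥ N₀, x (partialProd c (N + 1)) ≤ x (partialProd c N) := by
    intro N hN
    have h1 := hN₀ (N + 1) (by omega)
    have hpos : 0 < ‖c (N + 1)‖ := lt_of_lt_of_le one_pos ((le_max_left _ _).trans h1)
    rw [partialProd_succ, map_mul]
    refine mul_le_of_le_one_right (x.nonneg _) ?_
    rw [sub_eq_add_neg]
    refine (x.add_le_max _ _).trans (max_le (map_one x).le ?_)
    rw [map_neg_eq_map, map_mul, map_C, norm_inv, inv_mul_le_iff₀ hpos, mul_one]
    exact (le_max_right _ _).trans h1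
  refine ⟨∑ i ∈ Finset.range (N₀ + 1), x (partialProd c i), fun N => ?_⟩
  have hmono : ∀ k, x (partialProd c (N₀ + k)) ≤ x (partialProd c N₀) := by
    intro k
    induction k with
    | zero => exact le_rfl
    | succ k ih => exact (hstep (N₀ + k) (by omega)).trans ih
  have hle : ∀ i ≤ N₀, x (partialProd c i) ≤
      ∑ i ∈ Finset.range (N₀ + 1), x (partialProd c i) := fun i hi =>
    Finset.single_le_sum (f := fun i => x (partialProd c i)) (fun _ _ => x.nonneg _)
      (Finset.mem_range.2 (by omega))
  rcases le_total N N₀ with h | h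
  · exact hle N h
  · obtain ⟨k, rfl⟩ := Nat.exists_eq_add_of_le h
    exact (hmono k).trans (hle N₀ le_rfl)

theorem tendsto_partialProd_sub (c : Param p) (x : BerkovichLine p) {δ : ℝ} (hδ : 0 < δ) :
    ∃ N₀, ∀ N ≥ N₀, ∀ M ≥ N, x (partialProd c M - partialProd c N) ≤ δ := by
  obtain ⟨B, hB⟩ := exists_bound_partialProd c x
  have hB0 : 0 ≤ B := (x.nonneg _).trans (hB 0)
  obtain ⟨N₀, hN₀⟩ := eventually_atTop.1
    (c.tendsto_norm.eventually_ge_atTop (max 1 (B * x X / δ)))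
  have hstep : ∀ N ≥ N₀, x (partialProd c (N + 1) - partialProd c N) ≤ δ := by
    intro N hN
    have h1 := hN₀ (N + 1) (by omega)
    have hpos : 0 < ‖c (N + 1)‖ := lt_of_lt_of_le one_pos ((le_max_left _ _).trans h1)
    have h2 : B * x X / δ ≤ ‖c (N + 1)‖ := (le_max_right _ _).trans h1
    rw [div_le_iff₀ hδ] at h2
    have h3 : partialProd c (N + 1) - partialProd c N =
        -(partialProd c N * (C (c (N + 1))⁻¹ * X)) := by
      rw [partialProd_succ]; ring
    rw [h3, map_neg_eq_map, map_mul, map_mul, map_C, norm_inv]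
    calc x (partialProd c N) * (‖c (N + 1)‖⁻¹ * x X)
        ≤ B * (‖c (N + 1)‖⁻¹ * x X) :=
          mul_le_mul_of_nonneg_right (hB N) (mul_nonneg (inv_nonneg.2 hpos.le) (x.nonneg _))
      _ = ‖c (N + 1)‖⁻¹ * (B * x X) := by ring
      _ ≤ δ := by rw [inv_mul_le_iff₀ hpos]; exact h2
  refine ⟨N₀, fun N hN M hM => ?_⟩
  induction M, hM using Nat.le_induction with
  | base => simpa using hδ.le
  | succ M hM ih =>
    have : partialProd c (M + 1) - partialProd c N =
        (partialProd c (M + 1) - partialProd c M) + (partialProd c M - partialProd c N) := by ring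
    rw [this]
    exact (x.add_le_max _ _).trans (max_le (hstep M (hN.trans hM)) ih)

/-- Composition with a fixed polynomial is bounded and Lipschitz on bounded sets. -/
theorem exists_lipschitz_comp (x : BerkovichLine p) (B : ℝ) (g : ℂ_[p][X]) :
    ∃ K : ℝ, 0 ≤ K ∧ ∀ P Q : ℂ_[p][X], x P ≤ B → x Q ≤ B →
      x (g.comp P) ≤ K ∧ x (g.comp P - g.comp Q) ≤ K * x (P - Q) := by
  induction g using Polynomial.induction_on with
  | C a =>
    refine ⟨‖a‖, norm_nonneg a, fun P Q _ _ => ?_⟩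
    simp only [C_comp, sub_self, map_zero, map_C, le_refl, true_and]
    exact mul_nonneg (norm_nonneg a) (x.nonneg _)
  | add g h hg hh =>
    obtain ⟨K, hK, h1⟩ := hg
    obtain ⟨K', hK', h2⟩ := hh
    refine ⟨K + K', add_nonneg hK hK', fun P Q hP hQ => ⟨?_, ?_⟩⟩
    · rw [add_comp]
      exact (map_add_le_add x _ _).trans (add_le_add (h1 P Q hP hQ).1 (h2 P Q hP hQ).1)
    · have : (g + h).comp P - (g + h).comp Q =
          (g.comp P - g.comp Q) + (h.comp P - h.comp Q) := by
        rw [add_comp, add_comp]; ring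
      rw [this, add_mul]
      exact (map_add_le_add x _ _).trans (add_le_add (h1 P Q hP hQ).2 (h2 P Q hP hQ).2)
  | monomial n a ih =>
    obtain ⟨K, hK, h1⟩ := ih
    refine ⟨K * |B| + K, by positivity, fun P Q hP hQ => ?_⟩
    have hP' : x P ≤ |B| := hP.trans (le_abs_self B)
    have e : ∀ P : ℂ_[p][X], (C a * X ^ (n + 1)).comp P = (C a * X ^ n).comp P * P := by
      intro P
      simp [pow_succ, mul_assoc]
    obtain ⟨h2, h3⟩ := h1 P Q hP hQ
    have h4 := (h1 Q P hQ hP).1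
    have h5 := x.nonneg (P - Q)
    constructor
    · rw [e, map_mul]
      have := mul_le_mul h2 hP' (x.nonneg _) hK
      linarith
    · have : (C a * X ^ (n + 1)).comp P - (C a * X ^ (n + 1)).comp Q =
          ((C a * X ^ n).comp P - (C a * X ^ n).comp Q) * P + (C a * X ^ n).comp Q * (P - Q) := by
        rw [e, e]; ring
      rw [this]
      refine (map_add_le_add x _ _).trans ?_
      rw [map_mul, map_mul]
      have h6 := mul_le_mul h3 hP' (x.nonneg _) (mul_nonneg hK h5)
      have h7 := mul_le_mul_of_nonneg_right h4 h5
      nlinarith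

theorem cauchySeq_comp_partialProd (c : Param p) (x : BerkovichLine p) (g : ℂ_[p][X]) :
    CauchySeq (fun N => x (g.comp (partialProd c N))) := by
  obtain ⟨B, hB⟩ := exists_bound_partialProd c x
  obtain ⟨K, hK, hlip⟩ := exists_lipschitz_comp x B g
  rw [Metric.cauchySeq_iff']
  intro δ hδ
  obtain ⟨N₀, h⟩ := tendsto_partialProd_sub c x (δ := δ / (K + 1)) (by positivity)
  refine ⟨N₀, fun N hN => ?_⟩
  rw [Real.dist_eq]
  have h1 := (hlip _ _ (hB N) (hB N₀)).2
  have h2 : |x (g.comp (partialProd c N)) - x (g.comp (partialProd c N₀))| ≤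
      x (g.comp (partialProd c N) - g.comp (partialProd c N₀)) :=
    abs_sub_map_le_sub x _ _
  have h3 : K * (δ / (K + 1)) < δ := by
    rw [mul_div_assoc', div_lt_iff₀ (by positivity)]
    nlinarith
  exact lt_of_le_of_lt (h2.trans (h1.trans
    (mul_le_mul_of_nonneg_left (h N₀ le_rfl N hN) hK))) h3

theorem tendsto_comp_partialProd (c : Param p) (x : BerkovichLine p) (g : ℂ_[p][X]) :
    Tendsto (fun N => x (g.comp (partialProd c N))) atTop
      (𝓝 (limUnder atTop fun N => x (g.comp (partialProd c N)))) :=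
  tendsto_nhds_limUnder (cauchySeq_tendsto_of_complete (cauchySeq_comp_partialProd c x g))

end BerkovichLine

open BerkovichLine in
/-- The action of `f_c` on the Berkovich affine line. The image of the seminorm `x` is the seminorm
`g ↦ |g ∘ f_c|_x`, where the entire function `g ∘ f_c` is evaluated at `x` as the limit of the
polynomials `g ∘ F_N`, with `F_N` the partial products of `f_c`. -/
def berkovichMap (c : Param p) (x : BerkovichLine p) : BerkovichLine p where
  toFun g := limUnder atTop fun N => x (g.comp (partialProd c N))
  map_zero' := tendsto_nhds_unique (tendsto_comp_partialProd c x 0) (by simp)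
  map_one' := tendsto_nhds_unique (tendsto_comp_partialProd c x 1) (by simp)
  map_mul' g h := tendsto_nhds_unique (tendsto_comp_partialProd c x (g * h)) (by
    simpa using (tendsto_comp_partialProd c x g).mul (tendsto_comp_partialProd c x h))
  add_le' g h := le_of_tendsto_of_tendsto' (tendsto_comp_partialProd c x (g + h))
    ((tendsto_comp_partialProd c x g).add (tendsto_comp_partialProd c x h)) fun N => by
      rw [add_comp]; exact map_add_le_add x _ _
  neg' g := tendsto_nhds_unique (tendsto_comp_partialProd c x (-g)) (by
    simpa using tendsto_comp_partialProd c x g)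
  map_C' a := tendsto_nhds_unique (tendsto_comp_partialProd c x (C a)) (by
    simpa only [C_comp, BerkovichLine.map_C] using tendsto_const_nhds)

theorem norm_prod_one_add_sub_one_le {ι : Type*} (s : Finset ι) (a : ι → ℂ_[p]) {δ : ℝ}
    (hδ0 : 0 ≤ δ) (hδ1 : δ ≤ 1) (ha : ∀ i ∈ s, ‖a i‖ ≤ δ) : ‖∏ i ∈ s, (1 + a i) - 1‖ ≤ δ := by
  classical
  induction s using Finset.induction_on with
  | empty => simpa using hδ0
  | insert i s hi ih =>
    have h1 := ih fun k hk => ha k (Finset.mem_insert_of_mem hk)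
    have h2 := ha i (Finset.mem_insert_self i s)
    have h3 : ∏ k ∈ insert i s, (1 + a k) - 1 =
        (∏ k ∈ s, (1 + a k) - 1) + a i * ((∏ k ∈ s, (1 + a k) - 1) + 1) := by
      rw [Finset.prod_insert hi]; ring
    rw [h3]
    refine (IsUltrametricDist.norm_add_le_max _ _).trans (max_le h1 ?_)
    rw [norm_mul]
    have h4 : ‖(∏ k ∈ s, (1 + a k) - 1) + 1‖ ≤ 1 :=
      (IsUltrametricDist.norm_add_le_max _ _).trans (max_le (h1.trans hδ1) (by simp))
    exact (mul_le_of_le_one_right (norm_nonneg _) h4).trans h2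

/-- The infinite product defining `f_c` converges unconditionally. -/
theorem multipliable_one_sub_div (c : Param p) (z : ℂ_[p]) :
    Multipliable fun j : ℕ => 1 - z / c (j + 1) := by
  have hlim : Tendsto (fun j : ℕ => ‖-(z / c (j + 1))‖) atTop (𝓝 0) := by
    have h1 : Tendsto (fun j : ℕ => ‖c (j + 1)‖) atTop atTop :=
      c.tendsto_norm.comp (tendsto_add_atTop_nat 1)
    have h2 := h1.const_div_atTop ‖z‖
    simpa [norm_neg, norm_div] using h2
  set a : ℕ → ℂ_[p] := fun j => -(z / c (j + 1)) with ha
  have hf : (fun j : ℕ => 1 - z / c (j + 1)) = fun j => 1 + a j := by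
    funext j; simp [ha, sub_eq_add_neg]
  rw [hf]
  obtain ⟨N₁, hN₁⟩ := eventually_atTop.1 (hlim.eventually_le_const one_pos)
  set B : ℝ := ‖∏ j ∈ Finset.range N₁, (1 + a j)‖ with hB
  have hB0 : 0 ≤ B := norm_nonneg _
  have hcauchy : CauchySeq fun s : Finset ℕ => ∏ j ∈ s, (1 + a j) := by
    rw [Metric.cauchySeq_iff']
    intro δ hδ
    have hη : 0 < min 1 (δ / (B + 1)) := by positivity
    obtain ⟨N₂, hN₂⟩ := eventually_atTop.1 (hlim.eventually_le_const hη)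
    set N := max N₁ N₂
    have hbd : ‖∏ j ∈ Finset.range N, (1 + a j)‖ ≤ B := by
      rw [← Finset.prod_range_mul_prod_Ico _ (le_max_left N₁ N₂), norm_mul]
      refine mul_le_of_le_one_right hB0 ?_
      have := norm_prod_one_add_sub_one_le (Finset.Ico N₁ N) a zero_le_one le_rfl
        (fun i hi => hN₁ i (Finset.mem_Ico.1 hi).1)
      have h4 := (IsUltrametricDist.norm_add_le_max (∏ j ∈ Finset.Ico N₁ N, (1 + a j) - 1) 1)
      rw [sub_add_cancel] at h4
      exact h4.trans (max_le this (by simp))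
    refine ⟨Finset.range N, fun s hs => ?_⟩
    have hs' : Finset.range N ⊆ s := hs
    rw [dist_eq_norm, ← Finset.prod_sdiff hs']
    have h5 := norm_prod_one_add_sub_one_le (s \ Finset.range N) a hη.le (min_le_left _ _)
      (fun i hi => hN₂ i (by
        have := (Finset.mem_sdiff.1 hi).2
        have h6 : N₂ ≤ N := le_max_right _ _
        rw [Finset.mem_range] at this
        omega))
    have h6 : (∏ x ∈ s \ Finset.range N, (1 + a x)) * ∏ x ∈ Finset.range N, (1 + a x) -
        ∏ x ∈ Finset.range N, (1 + a x) =
        (∏ x ∈ s \ Finset.range N, (1 + a x) - 1) * ∏ x ∈ Finset.range N, (1 + a x) := by ring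
    rw [h6, norm_mul]
    have h7 := mul_le_mul (h5.trans (min_le_right _ _)) hbd (norm_nonneg _) (by positivity)
    refine lt_of_le_of_lt h7 ?_
    rw [div_mul_eq_mul_div, div_lt_iff₀ (by positivity)]
    nlinarith
  obtain ⟨L, hL⟩ := cauchySeq_tendsto_of_complete hcauchy
  exact ⟨L, hL⟩

theorem tendsto_eval_partialProd (c : Param p) (z : ℂ_[p]) :
    Tendsto (fun N => (partialProd c N).eval z) atTop (𝓝 (entireMap c z)) := by
  have h := (multipliable_one_sub_div c z).hasProd.tendsto_prod_nat.const_mul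
    (z ^ p / (p : ℂ_[p]))
  refine h.congr fun N => ?_
  simp only [partialProd, eval_mul, eval_C, eval_pow, eval_X, eval_prod, eval_sub, eval_one]
  rw [div_eq_inv_mul]
  congr 1
  exact Finset.prod_congr rfl fun j _ => by rw [div_eq_inv_mul]

/-- On classical points, the action on the Berkovich line is the entire function `f_c`. -/
theorem berkovichMap_ofPoint (c : Param p) (z : ℂ_[p]) :
    berkovichMap c (BerkovichLine.ofPoint z) = BerkovichLine.ofPoint (entireMap c z) := by
  refine DFunLike.ext _ _ fun g => ?_
  refine tendsto_nhds_unique (BerkovichLine.tendsto_comp_partialProd c _ g) ?_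
  have h := ((g.continuous.tendsto _).comp (tendsto_eval_partialProd c z)).norm
  refine h.congr fun N => ?_
  change _ = ‖(g.comp (partialProd c N)).eval z‖
  rw [eval_comp]
  rfl

/-! ### Radii, parameters and the quantities attached to them -/

variable (p) in
/-- The parameter space `𝒞(r)` of the sequence of radii `r = (R_j)_{j ≥ 1}`. -/
def paramSpace (R : ℕ → ℝ) : Set (Param p) := {c | ∀ j, 1 ≤ j → ‖c j‖ = R j}

/-- `φ(t) = sup {|f_c(z)| : |z| ≤ t}`. -/
def phi (c : Param p) (t : ℝ) : ℝ := sSup {s | ∃ z : ℂ_[p], ‖z‖ ≤ t ∧ s = ‖entireMap c z‖}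

variable (p) in
/-- Generic sequences of radii `(R_j)_{j ≥ 1}`. The function `φ` is the same for all parameters in
`𝒞(r)`. -/
structure IsGenericRadii (R : ℕ → ℝ) : Prop where
  increasing : ∀ i j, 1 ≤ i → i < j → R i < R j
  tendsto : Tendsto R atTop atTop
  lt_first : (p : ℝ) < R 1
  generic : ∀ c ∈ paramSpace p R, ∀ i j n, 1 ≤ i → i < j → 1 ≤ n → (phi c)^[n] (R i) ≠ R j

/-- `S_j = φ⁻¹(R_j)`, for the bijection `φ` of `]0, ∞[` and `R_j = |c_j|`. -/
def invRadius (c : Param p) (j : ℕ) : ℝ := Function.invFunOn (phi c) (Set.Ioi 0) ‖c j‖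

/-- The fixed point `w_j(c)` of `f_c` in `B_j = D(c_j, |c_j|)`, for `j ≥ 1`. -/
def fixedPt (c : Param p) (j : ℕ) : ℂ_[p] :=
  Classical.epsilon fun w => ‖w - c j‖ < ‖c j‖ ∧ entireMap c w = w

/-- The multiplier `λ_j = f_c'(w_j(c))`, for `j ≥ 1`. -/
def multiplier (c : Param p) (j : ℕ) : ℂ_[p] := deriv (entireMap c) (fixedPt c j)

variable (p) in
/-- `ϱ = p ^ (-1 / (p - 1))`. -/
def rho : ℝ := (p : ℝ) ^ (-1 / ((p : ℝ) - 1))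

/-! ### Symbolic dynamics -/

/-- The alphabet `{A, B_0, B_1, B_2, …}`. -/
inductive Letter
  | A
  | B (j : ℕ)

/-- `B_0 = 𝒟(0, 1)` and `B_j = 𝒟(c_j, |c_j|)` for `j ≥ 1`. -/
def regionB (c : Param p) (j : ℕ) : Set (BerkovichLine p) :=
  if j = 0 then BerkovichLine.disk 0 1 else BerkovichLine.disk (c j) ‖c j‖

/-- The piece of the dynamical partition named by a letter. -/
def region (c : Param p) : Letter → Set (BerkovichLine p)
  | Letter.A => (⋃ j, regionB c j)ᶜ
  | Letter.B j => regionB c j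

/-- The cylinder `C_c(α)` of a finite word `α`. -/
def cylinder (c : Param p) (α : List Letter) : Set (BerkovichLine p) :=
  {x | ∀ n (hn : n < α.length), (berkovichMap c)^[n] x ∈ region c α[n]}

/-- The transition time `n_j = min {n ≥ 1 : f_c^{-(n+1)}(B_j) ∩ B_0 ≠ ∅}`, for `j ≥ 1`. -/
def transitTime (c : Param p) (j : ℕ) : ℕ :=
  sInf {n | 1 ≤ n ∧ (((berkovichMap c)^[n + 1]) ⁻¹' regionB c j ∩ regionB c 0).Nonempty}

/-- The word `B_0^{m_j} A^{n_j}`. -/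
def excursion (n m : ℕ → ℕ) (j : ℕ) : List Letter :=
  List.replicate (m j) (Letter.B 0) ++ List.replicate (n j) Letter.A

/-- The `k`-th truncation
`α^{(k)} = B_0^{m_1} A^{n_1} B_1^{ℓ_2} ⋯ B_{k-1}^{ℓ_k} B_0^{m_k} A^{n_k} B_k`, for `k ≥ 1`. -/
def truncation (n m ℓ : ℕ → ℕ) (k : ℕ) : List Letter :=
  (List.range' 1 (k - 1)).flatMap
      (fun j => excursion n m j ++ List.replicate (ℓ (j + 1)) (Letter.B j))
    ++ excursion n m k ++ [Letter.B k]

/-- `Δ_k(c, ε)`: the parameters `c'` with `c'_j = c_j` for `j < k` and `|c_j - c'_j| < ε_j` for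
`j ≥ k`. -/
def perturbations (k : ℕ) (c : Param p) (ε : ℕ → ℝ) : Set (Param p) :=
  {c' | (∀ j, 1 ≤ j → j < k → c j = c' j) ∧ ∀ j, 1 ≤ j → k ≤ j → ‖c j - c' j‖ < ε j}

end CylStab

end

/-!
The cylinders for `c` and `c'` are compared by following the two orbits of one point. A point `x` of
the Berkovich line is the image of the class of `z` in its completed residue ring, a complete normed
`ℂ_p`-algebra with multiplicative norm (`pointOf_coord`); the maps `f_c` and `f_{c'}`
act on the elements of this ring (`berkovichMap_pointOf`), so distances of orbits make sense. Since
`f_c` is a limit of products of linear factors, a bound for the relative change of every factor is a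
bound for the relative change of its value (`norm_evalMap_sub_le_of_factor`).

Let `E` be the supremum of `ε_k / R_k ^ 2` over `k > k₀`; it bounds the changes of the inverses
`1 / c_k`. In one step from `y` the perturbation creates a relative error of at most `|y| E`.
Relative errors do not grow in `A`. In `B_0` they become `max(e / p, e ^ p)`, hence are divided by
`p` if `e ≤ ϱ`. In `B_j` distances grow by the factor `Φ(R_j) / R_j`, where `Φ` is the function `φ`
in closed form (`phi_eq_gauge`). That factor is `|λ_j|` (`Param.IsSeparated.norm_multiplier`), as
`f_c` is a dilation on `B_j` with a fixed point there.

An orbit that stays in `A` before reaching `B_j` has norms that follow `Φ`; genericity keeps these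
away from all `R_i`, so a relative error below `1` does not change the itinerary. The largest of
these norms, the one just before `B_j`, is `S_j`. Hence a relative error of at most `S_j E` reaches `B_j`, and
after `B_j^{ℓ_{j+1}}` the distance is at most `R_j S_j |λ_j| ^ ℓ_{j+1} E`. The stability hypothesis
makes this small enough for errors to contract in the next excursion, and by transversality its
contribution has dropped below `S_{j+1} E` at the end of that excursion, so that the induction
(`mem_cylinder_tailWord`) continues. In the last excursion it suffices that the relative error stays
below `1`. The relation between `c` and `c'` is symmetric, so one inclusion is enough. The radius
`S_j` comes from the orbit itself: an excursion `B_0^m A^n B_j` that no orbit makes has an empty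
cylinder.
-/

noncomputable section

set_option linter.unusedSectionVars false

namespace CylStab

section

variable {p : ℕ} [hp : Fact p.Prime]

/-! ### The completed residue ring of a point -/

namespace BerkovichLine

/-- The ring `ℂ_p[z]` carrying the seminorm `x`; a type synonym. -/
def SeminormedPoly (_ : BerkovichLine p) : Type := ℂ_[p][X]

instance (x : BerkovichLine p) : CommRing x.SeminormedPoly :=
  inferInstanceAs (CommRing ℂ_[p][X])

instance (x : BerkovichLine p) : Algebra ℂ_[p] x.SeminormedPoly :=
  inferInstanceAs (Algebra ℂ_[p] ℂ_[p][X])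

/-- The seminorm `x`, with submultiplicativity only. -/
def toRingSeminorm (x : BerkovichLine p) : RingSeminorm x.SeminormedPoly where
  toFun g := x g
  map_zero' := map_zero x
  add_le' := map_add_le_add x
  neg' := map_neg_eq_map x
  mul_le' g h := (map_mul x g h).le

instance (x : BerkovichLine p) : SeminormedCommRing x.SeminormedPoly where
  __ := x.toRingSeminorm.toSeminormedRing
  mul_comm := mul_comm

instance (x : BerkovichLine p) : NormedAlgebra ℂ_[p] x.SeminormedPoly where
  norm_smul_le a g := by
    change x (a • (show ℂ_[p][X] from g)) ≤ ‖a‖ * x g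
    rw [smul_eq_C_mul, map_mul, map_C]

/-- The completed residue ring of a point `x`: the Hausdorff completion of `ℂ_p[z]` for the
seminorm `x`. -/
abbrev ResidueRing (x : BerkovichLine p) : Type := UniformSpace.Completion x.SeminormedPoly

instance (x : BerkovichLine p) : NormMulClass x.ResidueRing where
  norm_mul a b := by
    induction a, b using UniformSpace.Completion.induction_on₂ with
    | hp => exact isClosed_eq (by fun_prop) (by fun_prop)
    | ih a b =>
      rw [← UniformSpace.Completion.coe_mul]
      simp only [UniformSpace.Completion.norm_coe]
      exact map_mul x _ _

instance (x : BerkovichLine p) : NormOneClass x.ResidueRing where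
  norm_one := by
    rw [← UniformSpace.Completion.coe_one, UniformSpace.Completion.norm_coe]
    exact map_one x

instance (x : BerkovichLine p) : IsUltrametricDist x.ResidueRing :=
  IsUltrametricDist.isUltrametricDist_of_forall_norm_add_le_max_norm fun a b => by
    induction a, b using UniformSpace.Completion.induction_on₂ with
    | hp => exact isClosed_le (by fun_prop) (by fun_prop)
    | ih a b =>
      rw [← UniformSpace.Completion.coe_add]
      simp only [UniformSpace.Completion.norm_coe]
      exact x.add_le_max _ _

/-- The class of the coordinate `z` in the completed residue ring. -/
def coord (x : BerkovichLine p) : x.ResidueRing :=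
  UniformSpace.Completion.coe' (α := x.SeminormedPoly) (X : ℂ_[p][X])

theorem norm_aeval_coord (x : BerkovichLine p) (g : ℂ_[p][X]) : ‖aeval x.coord g‖ = x g := by
  have h : aeval x.coord g = UniformSpace.Completion.coe' (α := x.SeminormedPoly) g := by
    induction g using Polynomial.induction_on with
    | C a =>
      rw [aeval_C]
      rfl
    | add g h hg hh =>
      rw [map_add, hg, hh]
      exact (UniformSpace.Completion.coe_add _ _).symm
    | monomial n a ih =>
      rw [pow_succ, ← mul_assoc, map_mul, ih, aeval_X, coord]
      exact (UniformSpace.Completion.coe_mul _ _).symm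
  rw [h]
  exact UniformSpace.Completion.norm_coe (E := x.SeminormedPoly) g

end BerkovichLine

/-! ### Points with values in an extension of `ℂ_p` -/

variable {K : Type*} [NormedCommRing K] [NormMulClass K] [NormOneClass K] [NormedAlgebra ℂ_[p] K]

/-- The point of the Berkovich line defined by an element of a normed extension of `ℂ_p`. -/
def pointOf (p : ℕ) [Fact p.Prime] {K : Type*} [NormedCommRing K] [NormMulClass K]
    [NormOneClass K] [NormedAlgebra ℂ_[p] K] (y : K) : BerkovichLine p where
  toFun g := ‖aeval y g‖
  map_zero' := by simp
  map_one' := by simp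
  map_mul' g h := by simp
  add_le' g h := by simpa using norm_add_le (aeval y g) (aeval y h)
  neg' g := by simp
  map_C' a := by rw [aeval_C, norm_algebraMap']

theorem pointOf_apply (y : K) (g : ℂ_[p][X]) : pointOf p y g = ‖aeval y g‖ := rfl

theorem pointOf_coord (x : BerkovichLine p) : pointOf p x.coord = x :=
  DFunLike.ext _ _ x.norm_aeval_coord

theorem pointOf_mem_disk (y : K) (a : ℂ_[p]) (r : ℝ) :
    pointOf p y ∈ BerkovichLine.disk a r ↔ ‖y - algebraMap ℂ_[p] K a‖ < r := by
  change ‖aeval y (X - C a)‖ < r ↔ _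
  simp

/-- The value of `f_c` at an element of a complete extension of `ℂ_p`. -/
def evalMap (c : Param p) (y : K) : K := limUnder atTop fun N => aeval y (partialProd c N)

variable [CompleteSpace K]

theorem tendsto_aeval_partialProd (c : Param p) (y : K) :
    Tendsto (fun N => aeval y (partialProd c N)) atTop (𝓝 (evalMap c y)) := by
  refine tendsto_nhds_limUnder (cauchySeq_tendsto_of_complete ?_)
  rw [Metric.cauchySeq_iff']
  intro δ hδ
  obtain ⟨N₀, h⟩ := BerkovichLine.tendsto_partialProd_sub c (pointOf p y) (half_pos hδ)
  refine ⟨N₀, fun N hN => ?_⟩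
  rw [dist_eq_norm, ← map_sub]
  exact (h N₀ le_rfl N hN).trans_lt (half_lt_self hδ)

theorem evalMap_eq_entireMap (c : Param p) (z : ℂ_[p]) : evalMap c z = entireMap c z :=
  tendsto_nhds_unique (tendsto_aeval_partialProd c z) (by
    simpa using tendsto_eval_partialProd c z)

theorem berkovichMap_pointOf (c : Param p) (y : K) :
    berkovichMap c (pointOf p y) = pointOf p (evalMap c y) := by
  refine DFunLike.ext _ _ fun g => ?_
  refine tendsto_nhds_unique (BerkovichLine.tendsto_comp_partialProd c _ g) ?_
  have h := (((g.continuous_aeval (A := K)).tendsto _).comp (tendsto_aeval_partialProd c y)).norm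
  refine h.congr fun N => ?_
  rw [pointOf_apply, aeval_comp]
  rfl

end

section

variable {p : ℕ} [hp : Fact p.Prime]
variable {K : Type*} [NormedCommRing K] [NormMulClass K] [NormOneClass K] [NormedAlgebra ℂ_[p] K]

/-! ### Norms of values of `f_c` -/

/-- The gauge `Φ_c(t) = p t ^ p ∏_{j ≥ 1} max(1, t / |c_j|)`, the norm of `f_c` on the points of
norm `t` at which no factor of `f_c` is small. Only finitely many factors differ from `1`. -/
def gauge (c : Param p) (t : ℝ) : ℝ := p * t ^ p * ∏' i : ℕ, max 1 (t / ‖c (i + 1)‖)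

theorem gauge_eq_of_forall {c : Param p} {t : ℝ} {N : ℕ} (h : ∀ i ≥ N, t / ‖c (i + 1)‖ ≤ 1) :
    gauge c t = p * t ^ p * ∏ i ∈ Finset.range N, max 1 (t / ‖c (i + 1)‖) := by
  rw [gauge, tprod_eq_prod (s := Finset.range N) fun i hi => max_eq_left (h i (by simpa using hi))]

theorem exists_forall_div_le_one (c : Param p) (t : ℝ) :
    ∃ N : ℕ, ∀ s ≤ t, ∀ i ≥ N, s / ‖c (i + 1)‖ ≤ 1 := by
  obtain ⟨N, hN⟩ := eventually_atTop.1 (c.tendsto_norm.eventually_ge_atTop (max 1 t))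
  refine ⟨N, fun s hs i hi => ?_⟩
  have h := hN (i + 1) (by omega)
  exact div_le_one_of_le₀ (hs.trans ((le_max_right _ _).trans h)) (norm_nonneg _)

theorem prime_pos_real : (0 : ℝ) < p := by exact_mod_cast hp.out.pos

theorem one_lt_prime_real : (1 : ℝ) < p := by exact_mod_cast hp.out.one_lt

theorem gauge_pos (c : Param p) {t : ℝ} (ht : 0 < t) : 0 < gauge c t := by
  obtain ⟨N, hN⟩ := exists_forall_div_le_one c t
  rw [gauge_eq_of_forall (hN t le_rfl)]
  have := prime_pos_real (p := p)
  have h : 0 < ∏ i ∈ Finset.range N, max 1 (t / ‖c (i + 1)‖) :=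
    Finset.prod_pos fun i _ => lt_max_of_lt_left one_pos
  positivity

/-- `Φ_c(t) / t` is nondecreasing. -/
theorem gauge_mul_le_gauge_mul (c : Param p) {s t : ℝ} (hs : 0 < s) (hst : s ≤ t) :
    gauge c s * t ≤ gauge c t * s := by
  obtain ⟨N, hN⟩ := exists_forall_div_le_one c t
  rw [gauge_eq_of_forall (hN t le_rfl), gauge_eq_of_forall (hN s hst)]
  have hp0 := prime_pos_real (p := p)
  have ht : 0 < t := hs.trans_le hst
  have h : ∏ i ∈ Finset.range N, max 1 (s / ‖c (i + 1)‖) ≤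
      ∏ i ∈ Finset.range N, max 1 (t / ‖c (i + 1)‖) :=
    Finset.prod_le_prod (fun i _ => zero_le_one.trans (le_max_left _ _))
      fun i _ => max_le_max le_rfl (div_le_div_of_nonneg_right hst (norm_nonneg _))
  have h0 : 0 < ∏ i ∈ Finset.range N, max 1 (s / ‖c (i + 1)‖) :=
    Finset.prod_pos fun i _ => lt_max_of_lt_left one_pos
  have h2 : s ^ p * t ≤ t ^ p * s := by
    obtain ⟨q, hq⟩ : ∃ q, p = q + 1 := ⟨p - 1, by have := hp.out.pos; omega⟩
    rw [hq, pow_succ, pow_succ]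
    have := pow_le_pow_left₀ hs.le hst q
    nlinarith [mul_pos hs ht]
  calc (p : ℝ) * s ^ p * (∏ i ∈ Finset.range N, max 1 (s / ‖c (i + 1)‖)) * t
      = p * ((s ^ p * t) * ∏ i ∈ Finset.range N, max 1 (s / ‖c (i + 1)‖)) := by ring
    _ ≤ p * ((t ^ p * s) * ∏ i ∈ Finset.range N, max 1 (t / ‖c (i + 1)‖)) := by gcongr
    _ = _ := by ring

theorem gauge_lt_gauge (c : Param p) {s t : ℝ} (hs : 0 < s) (hst : s < t) :
    gauge c s < gauge c t := by
  have h := gauge_mul_le_gauge_mul c hs hst.le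
  have h1 := gauge_pos c hs
  by_contra! hle
  nlinarith

theorem gauge_le_gauge (c : Param p) {s t : ℝ} (hs : 0 ≤ s) (hst : s ≤ t) :
    gauge c s ≤ gauge c t := by
  rcases hst.eq_or_lt with rfl | hlt
  · exact le_rfl
  rcases hs.eq_or_lt with rfl | h0
  · have : gauge c 0 = 0 := by simp [gauge, hp.out.ne_zero]
    rw [this]
    exact (gauge_pos c hlt).le
  · exact (gauge_lt_gauge c h0 hlt).le

theorem lt_gauge (c : Param p) {t : ℝ} (ht : 1 ≤ t) : t < gauge c t := by
  obtain ⟨N, hN⟩ := exists_forall_div_le_one c t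
  rw [gauge_eq_of_forall (hN t le_rfl)]
  have hp1 := one_lt_prime_real (p := p)
  have h : 1 ≤ ∏ i ∈ Finset.range N, max 1 (t / ‖c (i + 1)‖) :=
    Finset.one_le_prod fun i _ => le_max_left _ _
  have h2 : t ≤ t ^ p := le_self_pow₀ ht hp.out.ne_zero
  calc t < p * t := by nlinarith
    _ ≤ p * t ^ p := by gcongr
    _ ≤ _ := le_mul_of_one_le_right (by positivity) h

theorem gauge_congr {b c : Param p} (h : ∀ i, 1 ≤ i → ‖b i‖ = ‖c i‖) (t : ℝ) :
    gauge b t = gauge c t := by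
  simp only [gauge, h _ (Nat.le_add_left 1 _)]

/-- The `i`-th factor `1 - y / c_i` of `f_c(y)`; it is `1` for `c_i = 0`. -/
def factor (c : Param p) (i : ℕ) (y : K) : K := 1 - algebraMap ℂ_[p] K (c i)⁻¹ * y

theorem aeval_partialProd (c : Param p) (N : ℕ) (y : K) :
    aeval y (partialProd c N) = algebraMap ℂ_[p] K (p : ℂ_[p])⁻¹ * y ^ p *
      ∏ i ∈ Finset.range N, factor c (i + 1) y := by
  simp [partialProd, factor]

theorem norm_prime : ‖(p : ℂ_[p])‖ = (p : ℝ)⁻¹ := by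
  have h := PadicComplex.norm_extends' p (p : ℚ_[p])
  rw [Padic.norm_p] at h
  rw [← h]
  congr 1
  exact (map_natCast (algebraMap ℚ_[p] ℂ_[p]) p).symm

theorem norm_natCast_prime : ‖(p : K)‖ = (p : ℝ)⁻¹ := by
  rw [← map_natCast (algebraMap ℂ_[p] K), norm_algebraMap', norm_prime]

theorem norm_algebraMap_prime_inv : ‖algebraMap ℂ_[p] K (p : ℂ_[p])⁻¹‖ = p := by
  rw [norm_algebraMap', norm_inv, norm_prime, inv_inv]

theorem norm_algebraMap_inv_mul (a : ℂ_[p]) (y : K) :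
    ‖algebraMap ℂ_[p] K a⁻¹ * y‖ = ‖y‖ / ‖a‖ := by
  rw [norm_mul, norm_algebraMap', norm_inv, div_eq_inv_mul]

/-- Away from the zeros: every factor of `f_c(y)` has the largest norm that `|y|` allows. -/
def OffZeros (c : Param p) (y : K) : Prop :=
  ∀ i, 1 ≤ i → ‖factor c i y‖ = max 1 (‖y‖ / ‖c i‖)

variable [IsUltrametricDist K]

theorem norm_factor_le (c : Param p) (i : ℕ) (y : K) : ‖factor c i y‖ ≤ max 1 (‖y‖ / ‖c i‖) := by
  rw [factor, sub_eq_add_neg]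
  refine (IsUltrametricDist.norm_add_le_max _ _).trans ?_
  rw [norm_neg, norm_algebraMap_inv_mul, norm_one]

theorem norm_factor_of_ne {c : Param p} {i : ℕ} {y : K} (h : ‖y‖ ≠ ‖c i‖ ∨ c i = 0) :
    ‖factor c i y‖ = max 1 (‖y‖ / ‖c i‖) := by
  rcases eq_or_ne (c i) 0 with h0 | h0
  · simp [factor, h0]
  have hne : ‖(1 : K)‖ ≠ ‖-(algebraMap ℂ_[p] K (c i)⁻¹ * y)‖ := by
    rw [norm_neg, norm_algebraMap_inv_mul, norm_one]
    intro h1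
    rw [eq_comm, div_eq_one_iff_eq (norm_ne_zero_iff.2 h0)] at h1
    tauto
  rw [factor, sub_eq_add_neg, IsUltrametricDist.norm_add_eq_max_of_norm_ne_norm hne, norm_neg,
    norm_algebraMap_inv_mul, norm_one]

theorem norm_factor_eq_div {c : Param p} {i : ℕ} (h : c i ≠ 0) (y : K) :
    ‖factor c i y‖ = ‖y - algebraMap ℂ_[p] K (c i)‖ / ‖c i‖ := by
  have : factor c i y = -(algebraMap ℂ_[p] K (c i)⁻¹ * (y - algebraMap ℂ_[p] K (c i))) := by
    rw [mul_sub, ← map_mul, inv_mul_cancel₀ h, map_one, factor]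
    ring
  rw [this, norm_neg, norm_algebraMap_inv_mul]

variable [CompleteSpace K]

/-- The norms of the partial products at `y` are eventually constant. -/
theorem norm_evalMap (c : Param p) (y : K) {N : ℕ} (h : ∀ i ≥ N, ‖factor c (i + 1) y‖ = 1) :
    ‖evalMap c y‖ = p * ‖y‖ ^ p * ∏ i ∈ Finset.range N, ‖factor c (i + 1) y‖ := by
  refine tendsto_nhds_unique (tendsto_aeval_partialProd c y).norm ?_
  refine tendsto_const_nhds.congr' ?_
  filter_upwards [eventually_ge_atTop N] with M hM
  rw [aeval_partialProd, norm_mul, norm_mul, norm_algebraMap_prime_inv, norm_pow,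
    norm_prod, ← Finset.prod_range_mul_prod_Ico _ hM,
    Finset.prod_eq_one fun i hi => h i (Finset.mem_Ico.1 hi).1, mul_one]

theorem exists_forall_norm_factor_eq_one (c : Param p) (y : K) :
    ∃ N : ℕ, (∀ i ≥ N, ‖factor c (i + 1) y‖ = 1) ∧ ∀ i ≥ N, ‖y‖ / ‖c (i + 1)‖ ≤ 1 := by
  obtain ⟨N, hN⟩ := eventually_atTop.1 (c.tendsto_norm.eventually_gt_atTop ‖y‖)
  have h : ∀ i ≥ N, ‖y‖ / ‖c (i + 1)‖ ≤ 1 := fun i hi =>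
    div_le_one_of_le₀ (hN (i + 1) (by omega)).le (norm_nonneg _)
  refine ⟨N, fun i hi => ?_, h⟩
  rw [norm_factor_of_ne (Or.inl (hN (i + 1) (by omega)).ne), max_eq_left (h i hi)]

theorem norm_evalMap_le (c : Param p) (y : K) : ‖evalMap c y‖ ≤ gauge c ‖y‖ := by
  obtain ⟨N, h1, h2⟩ := exists_forall_norm_factor_eq_one c y
  rw [norm_evalMap c y h1, gauge_eq_of_forall h2]
  have : ∏ i ∈ Finset.range N, ‖factor c (i + 1) y‖ ≤
      ∏ i ∈ Finset.range N, max 1 (‖y‖ / ‖c (i + 1)‖) :=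
    Finset.prod_le_prod (fun i _ => norm_nonneg _) fun i _ => norm_factor_le c _ y
  gcongr

theorem OffZeros.norm_evalMap {c : Param p} {y : K} (h : OffZeros c y) :
    ‖evalMap c y‖ = gauge c ‖y‖ := by
  obtain ⟨N, h1, h2⟩ := exists_forall_norm_factor_eq_one c y
  rw [CylStab.norm_evalMap c y h1, gauge_eq_of_forall h2]
  congr 1
  exact Finset.prod_congr rfl fun i _ => h _ (Nat.le_add_left 1 i)

/-- The parameter `c` without its `j`-th zero: setting `c_j` to `0` turns the factor `1 - z / c_j`
into `1`. -/
def Param.erase (c : Param p) (j : ℕ) : Param p where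
  toFun := Function.update c j 0
  tendsto_norm := by
    refine c.tendsto_norm.congr' ?_
    filter_upwards [eventually_gt_atTop j] with i hi
    rw [Function.update_of_ne hi.ne']

theorem Param.erase_self (c : Param p) (j : ℕ) : c.erase j j = 0 := Function.update_self ..

theorem Param.erase_of_ne (c : Param p) {i j : ℕ} (h : i ≠ j) : c.erase j i = c i :=
  Function.update_of_ne h ..

/-- Splitting one factor off a product over the indices `1, …, N`. -/
theorem prod_range_erase {M : Type*} [CommMonoid M] {f g : ℕ → M} {j N : ℕ} (hj : 1 ≤ j)
    (hN : j ≤ N) (hfg : ∀ i, i ≠ j → f i = g i) (hg : g j = 1) :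
    ∏ i ∈ Finset.range N, f (i + 1) = (∏ i ∈ Finset.range N, g (i + 1)) * f j := by
  have hmem : j - 1 ∈ Finset.range N := Finset.mem_range.2 (by omega)
  have hj' : j - 1 + 1 = j := by omega
  rw [← Finset.mul_prod_erase _ _ hmem, ← Finset.mul_prod_erase (Finset.range N) _ hmem, hj', hg,
    one_mul, mul_comm]
  congr 1
  refine Finset.prod_congr rfl fun i hi => hfg _ ?_
  have := (Finset.mem_erase.1 hi).1
  omega

theorem evalMap_eq_erase_mul (c : Param p) {j : ℕ} (hj : 1 ≤ j) (y : K) :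
    evalMap c y = evalMap (c.erase j) y * factor c j y := by
  refine tendsto_nhds_unique (tendsto_aeval_partialProd c y) ?_
  refine ((tendsto_aeval_partialProd (c.erase j) y).mul_const (factor c j y)).congr' ?_
  filter_upwards [eventually_ge_atTop j] with N hN
  rw [aeval_partialProd, aeval_partialProd, mul_assoc,
    ← prod_range_erase (f := fun i => factor c i y) (g := fun i => factor (c.erase j) i y) hj hN]
  · intro i hi
    simp only [factor, c.erase_of_ne hi]
  · simp [factor, c.erase_self]

theorem gauge_eq_erase_mul (c : Param p) {j : ℕ} (hj : 1 ≤ j) (t : ℝ) :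
    gauge c t = gauge (c.erase j) t * max 1 (t / ‖c j‖) := by
  obtain ⟨N, hN⟩ := exists_forall_div_le_one c t
  obtain ⟨N', hN'⟩ := exists_forall_div_le_one (c.erase j) t
  have h1 := gauge_eq_of_forall (c := c) (t := t) (N := max j (max N N')) fun i hi =>
    hN t le_rfl i ((le_max_left _ _).trans ((le_max_right _ _).trans hi))
  have h2 := gauge_eq_of_forall (c := c.erase j) (t := t) (N := max j (max N N')) fun i hi =>
    hN' t le_rfl i ((le_max_right _ _).trans ((le_max_right _ _).trans hi))
  rw [h1, h2, mul_assoc (_ * _), ← prod_range_erase (f := fun i => max 1 (t / ‖c i‖))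
    (g := fun i => max 1 (t / ‖c.erase j i‖)) hj (le_max_left _ _)]
  · intro i hi
    simp only [c.erase_of_ne hi]
  · simp [c.erase_self]

end

section

variable {p : ℕ} [hp : Fact p.Prime]
variable {K : Type*} [NormedCommRing K] [NormMulClass K] [NormOneClass K] [NormedAlgebra ℂ_[p] K]
  [IsUltrametricDist K]

/-! ### One step of the dynamics under perturbation -/

theorem norm_le_of_norm_sub_le_mul {a b : K} {e : ℝ} (he : e ≤ 1) (h : ‖b - a‖ ≤ e * ‖a‖) :
    ‖b‖ ≤ ‖a‖ := by
  have h1 := IsUltrametricDist.norm_add_le_max (b - a) a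
  rw [sub_add_cancel] at h1
  exact h1.trans (max_le (h.trans (mul_le_of_le_one_left (norm_nonneg _) he)) le_rfl)

theorem norm_eq_of_norm_sub_lt {a b : K} (h : ‖b - a‖ < ‖a‖) : ‖b‖ = ‖a‖ := by
  have h1 := IsUltrametricDist.norm_add_eq_max_of_norm_ne_norm (x := b - a) (y := a) h.ne
  rwa [sub_add_cancel, max_eq_right h.le] at h1

theorem norm_eq_of_mem_disk {a : ℂ_[p]} {y : K} (h : ‖y - algebraMap ℂ_[p] K a‖ < ‖a‖) :
    ‖y‖ = ‖a‖ := by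
  have := norm_eq_of_norm_sub_lt (a := algebraMap ℂ_[p] K a) (b := y) (by rwa [norm_algebraMap'])
  rwa [norm_algebraMap'] at this

/-- A relative error bound passes to products. -/
theorem norm_mul_sub_mul_le {a b a' b' : K} {e : ℝ} (he : e ≤ 1)
    (ha : ‖a' - a‖ ≤ e * ‖a‖) (hb : ‖b' - b‖ ≤ e * ‖b‖) :
    ‖a' * b' - a * b‖ ≤ e * ‖a * b‖ := by
  have h : a' * b' - a * b = (a' - a) * b + a' * (b' - b) := by ring
  rw [h]
  have ha' := norm_le_of_norm_sub_le_mul he ha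
  refine (IsUltrametricDist.norm_add_le_max _ _).trans (max_le ?_ ?_)
  · rw [norm_mul, norm_mul, ← mul_assoc]
    gcongr
  · rw [norm_mul, norm_mul]
    calc ‖a'‖ * ‖b' - b‖ ≤ ‖a‖ * (e * ‖b‖) := by gcongr
      _ = e * (‖a‖ * ‖b‖) := by ring

theorem norm_prod_sub_prod_le {ι : Type*} (s : Finset ι) {u v : ι → K} {e : ℝ} (he0 : 0 ≤ e)
    (he : e ≤ 1) (h : ∀ i ∈ s, ‖v i - u i‖ ≤ e * ‖u i‖) :
    ‖∏ i ∈ s, v i - ∏ i ∈ s, u i‖ ≤ e * ‖∏ i ∈ s, u i‖ := by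
  classical
  induction s using Finset.induction_on with
  | empty => simpa using he0
  | insert i s hi ih =>
    rw [Finset.prod_insert hi, Finset.prod_insert hi]
    exact norm_mul_sub_mul_le he (h i (Finset.mem_insert_self i s))
      (ih fun k hk => h k (Finset.mem_insert_of_mem hk))

/-- Raising to the `p`-th power divides relative errors by `p` as long as they are at most
`p ^ (-1 / (p - 1))`; larger ones are raised to the `p`-th power. -/
theorem norm_pow_prime_sub_le {y y' : K} {e : ℝ} (he0 : 0 ≤ e) (he : e ≤ 1)
    (h : ‖y' - y‖ ≤ e * ‖y‖) :
    ‖y' ^ p - y ^ p‖ ≤ max (e / p) (e ^ p) * ‖y ^ p‖ := by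
  have hp2 := hp.out.two_le
  have hpp := prime_pos_real (p := p)
  set z := y' - y with hz
  have hzy : ‖z‖ ≤ ‖y‖ := h.trans (mul_le_of_le_one_left (norm_nonneg _) he)
  have hy' : y' = y + z := by rw [hz]; ring
  set S := ∑ k ∈ Finset.Ioo 0 p, y ^ (k - 1) * z ^ (p - k - 1) * ((p.choose k / p : ℕ) : K)
  have hS : ‖S‖ ≤ ‖y‖ ^ (p - 2) := by
    refine IsUltrametricDist.norm_sum_le_of_forall_le_of_nonneg (by positivity) fun k hk => ?_
    have hk' := Finset.mem_Ioo.1 hk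
    rw [norm_mul, norm_mul, norm_pow, norm_pow]
    calc ‖y‖ ^ (k - 1) * ‖z‖ ^ (p - k - 1) * ‖((p.choose k / p : ℕ) : K)‖
        ≤ ‖y‖ ^ (k - 1) * ‖y‖ ^ (p - k - 1) * 1 := by
          gcongr
          exact IsUltrametricDist.norm_natCast_le_one K _
      _ = ‖y‖ ^ (p - 2) := by
          rw [mul_one, ← pow_add]
          congr 1
          omega
  have hexp : y' ^ p - y ^ p = p * y * z * S + z ^ p := by
    rw [hy', add_pow_prime_eq hp.out]
    ring
  have hpw : ‖y‖ ^ p = ‖y‖ * ‖y‖ * ‖y‖ ^ (p - 2) := by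
    obtain ⟨q, hq⟩ : ∃ q, p = q + 2 := ⟨p - 2, by omega⟩
    rw [hq, Nat.add_sub_cancel]
    ring
  rw [hexp]
  refine (IsUltrametricDist.norm_add_le_max _ _).trans ?_
  rw [max_mul_of_nonneg _ _ (norm_nonneg _), norm_pow y]
  refine max_le_max ?_ ?_
  · rw [norm_mul, norm_mul, norm_mul, norm_natCast_prime]
    calc (p : ℝ)⁻¹ * ‖y‖ * ‖z‖ * ‖S‖ ≤ (p : ℝ)⁻¹ * ‖y‖ * (e * ‖y‖) * ‖y‖ ^ (p - 2) := by gcongr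
      _ = e / p * ‖y‖ ^ p := by rw [hpw]; ring
  · rw [norm_pow, ← mul_pow]
    gcongr

theorem norm_factor_sub_le {c c' : Param p} {i : ℕ} {E : ℝ} (hc : ‖c' i‖ = ‖c i‖)
    (hE : ‖(c' i)⁻¹ - (c i)⁻¹‖ ≤ E) (y y' : K) :
    ‖factor c' i y' - factor c i y‖ ≤ max (‖y' - y‖ / ‖c i‖) (‖y‖ * E) := by
  have h : factor c' i y' - factor c i y = -(algebraMap ℂ_[p] K (c' i)⁻¹ * (y' - y)) +
      -(algebraMap ℂ_[p] K ((c' i)⁻¹ - (c i)⁻¹) * y) := by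
    rw [factor, factor, map_sub]
    ring
  rw [h]
  refine (IsUltrametricDist.norm_add_le_max _ _).trans (max_le_max ?_ ?_)
  · rw [norm_neg, norm_algebraMap_inv_mul, hc]
  · rw [norm_neg, norm_mul, norm_algebraMap', mul_comm]
    gcongr

variable [CompleteSpace K]

/-- Relative error of `f_c`, from the relative errors of its factors. -/
theorem norm_evalMap_sub_le_of_factor {c c' : Param p} {y y' : K} {e : ℝ} (he0 : 0 ≤ e)
    (he : e ≤ 1) (hpow : ‖y' ^ p - y ^ p‖ ≤ e * ‖y ^ p‖)
    (hfac : ∀ i, 1 ≤ i → ‖factor c' i y' - factor c i y‖ ≤ e * ‖factor c i y‖) :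
    ‖evalMap c' y' - evalMap c y‖ ≤ e * ‖evalMap c y‖ := by
  refine le_of_tendsto_of_tendsto' ((tendsto_aeval_partialProd c' y').sub
    (tendsto_aeval_partialProd c y)).norm
    ((tendsto_aeval_partialProd c y).norm.const_mul e) fun N => ?_
  rw [aeval_partialProd, aeval_partialProd]
  refine norm_mul_sub_mul_le he ?_
    (norm_prod_sub_prod_le _ he0 he fun i _ => hfac _ (Nat.le_add_left 1 i))
  rw [← mul_sub, norm_mul, norm_mul, mul_left_comm]
  gcongr

/-- Parameters with zeros of the same norms, whose inverses are `E`-close. -/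
structure CloseParams (c c' : Param p) (E : ℝ) : Prop where
  norm_eq : ∀ i, 1 ≤ i → ‖c' i‖ = ‖c i‖
  inv_sub : ∀ i, 1 ≤ i → ‖(c' i)⁻¹ - (c i)⁻¹‖ ≤ E

theorem CloseParams.nonneg {c c' : Param p} {E : ℝ} (h : CloseParams c c' E) : 0 ≤ E :=
  (norm_nonneg _).trans (h.inv_sub 1 le_rfl)

theorem CloseParams.refl (c : Param p) : CloseParams c c 0 := ⟨fun _ _ => rfl, by simp⟩

theorem CloseParams.erase {c c' : Param p} {E : ℝ} (h : CloseParams c c' E) (j : ℕ) :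
    CloseParams (c.erase j) (c'.erase j) E where
  norm_eq i hi := by
    rcases eq_or_ne i j with rfl | hij
    · rw [c.erase_self, c'.erase_self]
    · rw [c.erase_of_ne hij, c'.erase_of_ne hij, h.norm_eq i hi]
  inv_sub i hi := by
    rcases eq_or_ne i j with rfl | hij
    · simpa [c.erase_self, c'.erase_self] using h.nonneg
    · rw [c.erase_of_ne hij, c'.erase_of_ne hij]
      exact h.inv_sub i hi

/-- Away from the zeros, `f_c` does not increase relative errors. -/
theorem OffZeros.norm_evalMap_sub_le {c c' : Param p} {E e : ℝ} (hcc : CloseParams c c' E)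
    {y y' : K} (hy : OffZeros c y) (he0 : 0 ≤ e) (he : e ≤ 1) (h : ‖y' - y‖ ≤ e * ‖y‖)
    (hE : ‖y‖ * E ≤ e) : ‖evalMap c' y' - evalMap c y‖ ≤ e * ‖evalMap c y‖ := by
  have hp1 := one_lt_prime_real (p := p)
  refine norm_evalMap_sub_le_of_factor he0 he ?_ fun i hi => ?_
  · refine (norm_pow_prime_sub_le he0 he h).trans ?_
    gcongr
    exact max_le (div_le_self he0 hp1.le) (pow_le_of_le_one he0 he hp.out.ne_zero)
  · refine (norm_factor_sub_le (hcc.norm_eq i hi) (hcc.inv_sub i hi) y y').trans ?_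
    rw [hy i hi]
    refine max_le ?_ (hE.trans (le_mul_of_one_le_right he0 (le_max_left _ _)))
    calc ‖y' - y‖ / ‖c i‖ ≤ e * ‖y‖ / ‖c i‖ := by gcongr
      _ = e * (‖y‖ / ‖c i‖) := mul_div_assoc ..
      _ ≤ e * max 1 (‖y‖ / ‖c i‖) := by gcongr; exact le_max_right _ _

/-- On the open unit disk, relative errors behave as under `z ↦ z ^ p`. -/
theorem norm_evalMap_sub_le_of_norm_lt_one {c c' : Param p} {E e κ : ℝ}
    (hcc : CloseParams c c' E) (hc : ∀ i, 1 ≤ i → (p : ℝ) ≤ ‖c i‖) {y y' : K} (hy : ‖y‖ < 1)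
    (he0 : 0 ≤ e) (he : e ≤ 1) (hκ : κ ≤ 1) (h : ‖y' - y‖ ≤ e * ‖y‖) (hE : ‖y‖ * E ≤ κ) :
    ‖evalMap c' y' - evalMap c y‖ ≤ max (max (e / p) (e ^ p)) κ * ‖evalMap c y‖ := by
  have hp1 := one_lt_prime_real (p := p)
  have hpp := prime_pos_real (p := p)
  have hη : max (e / p) (e ^ p) ≤ 1 :=
    (max_le (div_le_self he0 hp1.le) (pow_le_of_le_one he0 he hp.out.ne_zero)).trans he
  refine norm_evalMap_sub_le_of_factor (le_max_of_le_left (le_max_of_le_left (by positivity)))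
    (max_le hη hκ) ?_ fun i hi => ?_
  · refine (norm_pow_prime_sub_le he0 he h).trans ?_
    exact mul_le_mul_of_nonneg_right (le_max_left _ _) (norm_nonneg _)
  · refine (norm_factor_sub_le (hcc.norm_eq i hi) (hcc.inv_sub i hi) y y').trans ?_
    have h1 : ‖y‖ < ‖c i‖ := hy.trans (hp1.trans_le (hc i hi))
    rw [norm_factor_of_ne (Or.inl h1.ne),
      max_eq_left (div_le_one_of_le₀ h1.le (norm_nonneg _)), mul_one]
    refine max_le_max ((?_ : _ ≤ e / p).trans (le_max_left _ _)) hE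
    have h2 : ‖y' - y‖ ≤ e := h.trans (mul_le_of_le_one_right he0 hy.le)
    gcongr
    exact hc i hi

theorem gauge_erase_norm (c : Param p) {j : ℕ} (hj : 1 ≤ j) (h0 : c j ≠ 0) :
    gauge (c.erase j) ‖c j‖ = gauge c ‖c j‖ := by
  rw [gauge_eq_erase_mul c hj, div_self (norm_ne_zero_iff.2 h0), max_self, mul_one]

/-- `f_c` is a dilation of ratio `Φ_c(|c_j|) / |c_j|` on the disk `D(c_j, |c_j|)`. -/
theorem norm_evalMap_sub_le_of_mem_disk {c c' : Param p} {E δ : ℝ} (hcc : CloseParams c c' E)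
    {j : ℕ} (hj : 1 ≤ j) (h0 : c j ≠ 0) (hjj : c' j = c j) {y y' : K}
    (hy : ‖y - algebraMap ℂ_[p] K (c j)‖ < ‖c j‖) (hoff : OffZeros (c.erase j) y)
    (h : ‖y' - y‖ ≤ δ) (hδ : δ ≤ ‖c j‖) (hE : ‖c j‖ * E ≤ 1) :
    ‖evalMap c' y' - evalMap c y‖ ≤
      max (gauge c ‖c j‖ / ‖c j‖ * δ) (‖c j‖ * E * ‖evalMap c y‖) := by
  have hR : 0 < ‖c j‖ := norm_pos_iff.2 h0
  have hyR : ‖y‖ = ‖c j‖ := norm_eq_of_mem_disk hy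
  have hE0 := hcc.nonneg
  have hδ0 : 0 ≤ δ := (norm_nonneg _).trans h
  set e := max (δ / ‖c j‖) (‖c j‖ * E) with he
  have he0 : 0 ≤ e := le_max_of_le_left (by positivity)
  have he1 : e ≤ 1 := max_le (div_le_one_of_le₀ hδ hR.le) hE
  have hq := hoff.norm_evalMap_sub_le (hcc.erase j) he0 he1 (y' := y')
    (by
      rw [hyR]
      calc ‖y' - y‖ ≤ δ / ‖c j‖ * ‖c j‖ := by rwa [div_mul_cancel₀ _ hR.ne']
        _ ≤ e * ‖c j‖ := by gcongr; exact le_max_left _ _)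
    (by rw [hyR]; exact le_max_right _ _)
  have hqn : ‖evalMap (c.erase j) y‖ = gauge c ‖c j‖ := by
    rw [hoff.norm_evalMap, hyR, gauge_erase_norm c hj h0]
  have hqn' := norm_le_of_norm_sub_le_mul he1 hq
  rw [hqn] at hq hqn'
  have hG : 0 ≤ gauge c ‖c j‖ := (norm_nonneg _).trans_eq hqn
  have hu : factor c' j y' - factor c j y = -(algebraMap ℂ_[p] K (c j)⁻¹ * (y' - y)) := by
    rw [factor, factor, hjj]
    ring
  have hu1 : ‖factor c j y‖ ≤ 1 := by
    rw [norm_factor_eq_div h0]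
    exact div_le_one_of_le₀ hy.le hR.le
  have hsplit : evalMap c' y' - evalMap c y =
      evalMap (c'.erase j) y' * (factor c' j y' - factor c j y) +
      (evalMap (c'.erase j) y' - evalMap (c.erase j) y) * factor c j y := by
    rw [evalMap_eq_erase_mul c hj, evalMap_eq_erase_mul c' hj]
    ring
  have hfy : ‖evalMap c y‖ = gauge c ‖c j‖ * ‖factor c j y‖ := by
    rw [evalMap_eq_erase_mul c hj, norm_mul, hqn]
  rw [hsplit]
  refine (IsUltrametricDist.norm_add_le_max _ _).trans (max_le (le_max_of_le_left ?_) ?_)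
  · rw [norm_mul, hu, norm_neg, norm_algebraMap_inv_mul]
    calc _ ≤ gauge c ‖c j‖ * (δ / ‖c j‖) := by gcongr
      _ = _ := by ring
  · rw [norm_mul]
    refine (mul_le_mul_of_nonneg_right hq (norm_nonneg _)).trans ?_
    rw [he, max_mul_of_nonneg _ _ hG, max_mul_of_nonneg _ _ (norm_nonneg _)]
    refine max_le_max ?_ ?_
    · refine (mul_le_of_le_one_right (by positivity) hu1).trans_eq ?_
      ring
    · rw [hfy, mul_assoc]

end

section

variable {p : ℕ} [hp : Fact p.Prime]

/-! ### The function `φ` and the radii `S_j` -/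

/-- The value group of `ℂ_p` is dense, since `ℂ_p` contains all roots of `p`. -/
theorem exists_norm_mem_Ioo {a b : ℝ} (ha : 0 < a) (hab : a < b) :
    ∃ z : ℂ_[p], a < ‖z‖ ∧ ‖z‖ < b := by
  have hp1 := one_lt_prime_real (p := p)
  have hpp := prime_pos_real (p := p)
  -- a rational number in the interval of the logarithms in base `1 / p`
  obtain ⟨q, hq1, hq2⟩ := exists_rat_btwn
    (div_lt_div_of_pos_right (Real.log_lt_log ha hab) (Real.log_pos hp1))
  obtain ⟨w, hw⟩ := IsAlgClosed.exists_pow_nat_eq (p : ℂ_[p]) q.den_pos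
  have hp0 : (p : ℂ_[p]) ≠ 0 := by exact_mod_cast hp.out.ne_zero
  have hw0 : w ≠ 0 := by
    rintro rfl
    rw [zero_pow q.den_nz] at hw
    exact hp0 hw.symm
  have hwn : Real.log ‖w‖ = -(Real.log p / q.den) := by
    have h1 : ‖w‖ ^ q.den = (p : ℝ)⁻¹ := by rw [← norm_pow, hw, norm_prime]
    have h2 := congrArg Real.log h1
    rw [Real.log_pow, Real.log_inv] at h2
    have h3 : (q.den : ℝ) ≠ 0 := by exact_mod_cast q.den_nz
    field_simp
    linarith
  have hlog : Real.log ‖w ^ (-q.num)‖ = q * Real.log p := by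
    rw [norm_zpow, Real.log_zpow, hwn]
    have h4 : (q : ℝ) = q.num / q.den := by exact_mod_cast (Rat.num_div_den q).symm
    rw [h4]
    push_cast
    ring
  have hpos : 0 < ‖w ^ (-q.num)‖ := norm_pos_iff.2 (zpow_ne_zero _ hw0)
  refine ⟨w ^ (-q.num), ?_, ?_⟩
  · rw [← Real.log_lt_log_iff ha hpos, hlog]
    exact (div_lt_iff₀ (Real.log_pos hp1)).1 hq1
  · rw [← Real.log_lt_log_iff hpos (ha.trans hab), hlog]
    exact (lt_div_iff₀ (Real.log_pos hp1)).1 hq2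

theorem norm_entireMap_le (c : Param p) (z : ℂ_[p]) : ‖entireMap c z‖ ≤ gauge c ‖z‖ := by
  rw [← evalMap_eq_entireMap]
  exact norm_evalMap_le c z

theorem phi_eq_gauge (c : Param p) {t : ℝ} (ht : 0 < t) : phi c t = gauge c t := by
  have hub : ∀ s ∈ {s | ∃ z : ℂ_[p], ‖z‖ ≤ t ∧ s = ‖entireMap c z‖}, s ≤ gauge c t := by
    rintro s ⟨z, hz, rfl⟩
    exact (norm_entireMap_le c z).trans (gauge_le_gauge c (norm_nonneg _) hz)
  refine le_antisymm (csSup_le ⟨_, 0, by simpa using ht.le, rfl⟩ hub) ?_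
  refine le_of_forall_lt fun s hs => ?_
  obtain ⟨N, hN⟩ := exists_forall_div_le_one c t
  obtain ⟨N', hN'⟩ := eventually_atTop.1 (c.tendsto_norm.eventually_gt_atTop t)
  -- radii slightly below `t` avoid the norms of the zeros
  have hev : ∀ᶠ r in 𝓝[<] t, s < gauge c r ∧ 0 < r ∧ ∀ i ∈ Finset.range N', r ≠ ‖c i‖ := by
    refine Eventually.and ?_ (Eventually.and ?_ ?_)
    · have hcont : Continuous fun r : ℝ =>
          p * r ^ p * ∏ i ∈ Finset.range N, max 1 (r / ‖c (i + 1)‖) := by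
        refine Continuous.mul (by fun_prop) (continuous_finsetProd _ fun i _ => ?_)
        exact continuous_const.max (continuous_id.div_const _)
      have h1 := (hcont.tendsto t).eventually_const_lt (u := s)
        (by rwa [← gauge_eq_of_forall (hN t le_rfl)])
      filter_upwards [nhdsWithin_le_nhds h1, self_mem_nhdsWithin] with r hr hrt
      rwa [gauge_eq_of_forall (hN r (le_of_lt hrt))]
    · exact nhdsWithin_le_nhds (lt_mem_nhds ht)
    · rw [Filter.eventually_all_finset]
      intro i _
      rcases lt_or_ge ‖c i‖ t with h | h
      · filter_upwards [nhdsWithin_le_nhds (lt_mem_nhds h)] with r hr using ne_of_gt hr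
      · filter_upwards [self_mem_nhdsWithin] with r hr using ((show r < t from hr).trans_le h).ne
  obtain ⟨a, hat, ha⟩ := (mem_nhdsLT_iff_exists_Ioo_subset' (show (0 : ℝ) < t from ht)).1 hev
  obtain ⟨z, hz1, hz2⟩ := exists_norm_mem_Ioo (p := p) (a := max a (t / 2)) (b := t)
    (lt_max_of_lt_right (by positivity)) (max_lt hat (by linarith))
  obtain ⟨h1, -, h3⟩ := ha ⟨(le_max_left _ _).trans_lt hz1, hz2⟩
  have hoff : OffZeros c z := fun i _ => norm_factor_of_ne <| Or.inl <| by
    rcases lt_or_ge i N' with hi | hi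
    · exact h3 i (Finset.mem_range.2 hi)
    · exact (hz2.trans (hN' i hi)).ne
  refine h1.trans_le (le_csSup ⟨_, hub⟩ ⟨z, hz2.le, ?_⟩)
  rw [← evalMap_eq_entireMap, hoff.norm_evalMap]

theorem phi_iterate_eq_gauge (c : Param p) (n : ℕ) {t : ℝ} (ht : 0 < t) :
    (phi c)^[n] t = (gauge c)^[n] t := by
  induction n generalizing t with
  | zero => rfl
  | succ n ih =>
    rw [Function.iterate_succ_apply, Function.iterate_succ_apply, phi_eq_gauge c ht,
      ih (gauge_pos c ht)]

theorem invRadius_eq (c : Param p) {j : ℕ} {t : ℝ} (ht : 0 < t) (h : gauge c t = ‖c j‖) :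
    invRadius c j = t := by
  have hex : ∃ s ∈ Set.Ioi (0 : ℝ), phi c s = ‖c j‖ := ⟨t, ht, by rw [phi_eq_gauge c ht, h]⟩
  have hpos : 0 < invRadius c j := Function.invFunOn_mem hex
  have heq : phi c (invRadius c j) = ‖c j‖ := Function.invFunOn_eq hex
  rw [phi_eq_gauge c hpos, ← h] at heq
  rcases lt_trichotomy (invRadius c j) t with hlt | heq' | hlt
  · exact absurd heq (gauge_lt_gauge c hpos hlt).ne
  · exact heq'
  · exact absurd heq (gauge_lt_gauge c ht hlt).ne'

/-! ### The fixed point in `D(c_j, |c_j|)` and its multiplier -/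

/-- If `a_i → 0`, the product `∏ (1 + h a_i)` is differentiable at `h = 0`. -/
theorem differentiableAt_of_tendsto_prod {a : ℕ → ℂ_[p]} (ha : Tendsto a atTop (𝓝 0))
    {P : ℂ_[p] → ℂ_[p]}
    (hP : ∀ h, Tendsto (fun N => ∏ i ∈ Finset.range N, (1 + h * a i)) atTop (𝓝 (P h))) :
    DifferentiableAt ℂ_[p] P 0 := by
  obtain ⟨B, hB⟩ := ha.norm.bddAbove_range
  have hB' : ∀ i, ‖a i‖ ≤ B := fun i => hB ⟨i, rfl⟩
  have hB0 : 0 ≤ B := (norm_nonneg _).trans (hB' 0)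
  have hs : Summable a := NonarchimedeanAddGroup.summable_of_tendsto_cofinite_zero
    (by rwa [Nat.cofinite_eq_atTop])
  have hP0 : P 0 = 1 := tendsto_nhds_unique (hP 0) (by simp)
  have key : ∀ h : ℂ_[p], ‖h‖ * B ≤ 1 → ‖P h - 1 - h * ∑' i, a i‖ ≤ (‖h‖ * B) ^ 2 := by
    intro h hh
    have h1 := (((hP h).sub_const 1).sub (hs.hasSum.tendsto_sum_nat.const_mul h)).norm
    refine le_of_tendsto' h1 fun N => ?_
    induction N with
    | zero => simpa using sq_nonneg _
    | succ N ih =>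
      have h2 := norm_prod_one_add_sub_one_le (Finset.range N) (fun i => h * a i)
        (by positivity) hh fun i _ => by rw [norm_mul]; gcongr; exact hB' i
      have h3 : ∏ i ∈ Finset.range (N + 1), (1 + h * a i) - 1 -
          h * ∑ i ∈ Finset.range (N + 1), a i =
          (∏ i ∈ Finset.range N, (1 + h * a i) - 1 - h * ∑ i ∈ Finset.range N, a i) +
          (∏ i ∈ Finset.range N, (1 + h * a i) - 1) * (h * a N) := by
        rw [Finset.prod_range_succ, Finset.sum_range_succ]
        ring
      rw [h3]
      refine (IsUltrametricDist.norm_add_le_max _ _).trans (max_le ih ?_)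
      rw [norm_mul, norm_mul, sq]
      gcongr
      exact hB' N
  refine HasDerivAt.differentiableAt (f' := ∑' i, a i) ?_
  rw [hasDerivAt_iff_isLittleO_nhds_zero]
  refine (Asymptotics.IsBigO.of_bound (B ^ 2) (g := fun h : ℂ_[p] => ‖h‖ ^ 2) ?_).trans_isLittleO ?_
  · have hev : ∀ᶠ h : ℂ_[p] in 𝓝 0, ‖h‖ * B ≤ 1 := by
      have : Tendsto (fun h : ℂ_[p] => ‖h‖ * B) (𝓝 0) (𝓝 0) := by
        simpa using (tendsto_norm_zero (E := ℂ_[p])).mul_const B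
      exact this.eventually_le_const one_pos
    filter_upwards [hev] with h hh
    rw [zero_add, hP0, smul_eq_mul, norm_pow, norm_norm, ← mul_pow, mul_comm B]
    exact key h hh
  · rw [Asymptotics.isLittleO_iff]
    intro ε hε
    filter_upwards [Metric.ball_mem_nhds (0 : ℂ_[p]) hε] with h hh
    rw [mem_ball_zero_iff] at hh
    rw [norm_pow, norm_norm, sq]
    gcongr

/-- `f_c` is differentiable at `w ≠ c_j`: there `1 - (w + h) / c_j` is the product of `1 - w / c_j`
and `1 - h / (c_j - w)`. -/
theorem differentiableAt_entireMap (c : Param p) (hc : ∀ i, 1 ≤ i → c i ≠ 0) {w : ℂ_[p]}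
    (hw : entireMap c w ≠ 0) : DifferentiableAt ℂ_[p] (entireMap c) w := by
  have hne : ∀ i, 1 ≤ i → c i - w ≠ 0 := by
    intro i hi h
    rw [sub_eq_zero] at h
    refine hw ?_
    rw [← evalMap_eq_entireMap, evalMap_eq_erase_mul c hi]
    simp [factor, ← h, hc i hi]
  set d : Param p := ⟨fun i => c i - w, by
    refine tendsto_atTop_mono (fun i => norm_sub_norm_le (c i) w) ?_
    exact tendsto_atTop_add_const_right _ _ c.tendsto_norm⟩ with hd
  have hmul : ∀ h, entireMap c (w + h) =
      (w + h) ^ p / p * ((∏' i : ℕ, (1 - w / c (i + 1))) * ∏' i : ℕ, (1 - h / d (i + 1))) := by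
    intro h
    rw [entireMap, ← (multipliable_one_sub_div c w).tprod_mul (multipliable_one_sub_div d h)]
    congr 1
    refine tprod_congr fun i => ?_
    have h1 := hne (i + 1) (Nat.le_add_left 1 i)
    have h2 := hc (i + 1) (Nat.le_add_left 1 i)
    change _ = _ * (1 - h / (c (i + 1) - w))
    field_simp
    ring
  have hP : DifferentiableAt ℂ_[p] (fun h => ∏' i : ℕ, (1 - h / d (i + 1))) (w - w) := by
    rw [sub_self]
    refine differentiableAt_of_tendsto_prod (a := fun i => -(d (i + 1))⁻¹) ?_ fun h => ?_
    · rw [tendsto_zero_iff_norm_tendsto_zero]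
      simp only [norm_neg, norm_inv]
      exact (d.tendsto_norm.comp (tendsto_add_atTop_nat 1)).inv_tendsto_atTop
    · refine (multipliable_one_sub_div d h).hasProd.tendsto_prod_nat.congr fun N => ?_
      exact Finset.prod_congr rfl fun i _ => by ring
  have hf : entireMap c = fun z => z ^ p / (p : ℂ_[p]) *
      ((∏' i : ℕ, (1 - w / c (i + 1))) * (fun h => ∏' i : ℕ, (1 - h / d (i + 1))) (z - w)) := by
    funext z
    simpa using hmul (z - w)
  rw [hf]
  have hcomp := hP.comp (f := fun z => z - w) w (differentiableAt_id.sub_const w)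
  exact ((differentiableAt_id.pow p).div_const _).mul (hcomp.const_mul _)

/-- `|f_c'(w)| = Λ` when `|f_c(w + h) - f_c(w)| = Λ |h|` for small `h`. -/
theorem norm_deriv_eq_of_dilation {f : ℂ_[p] → ℂ_[p]} {w : ℂ_[p]} {Λ r : ℝ} (hr : 0 < r)
    (hf : DifferentiableAt ℂ_[p] f w) (h : ∀ z, ‖z - w‖ < r → ‖f z - f w‖ = Λ * ‖z - w‖) :
    ‖deriv f w‖ = Λ := by
  have h1 := hf.hasDerivAt.tendsto_slope.norm
  refine tendsto_nhds_unique h1 (tendsto_const_nhds.congr' ?_)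
  filter_upwards [nhdsWithin_le_nhds (Metric.ball_mem_nhds w hr), self_mem_nhdsWithin] with z hz hzw
  have hzw' : 0 < ‖z - w‖ := norm_pos_iff.2 (sub_ne_zero.2 hzw)
  rw [slope_def_field, norm_div, h z (by simpa [dist_eq_norm] using hz),
    mul_div_cancel_right₀ _ hzw'.ne']

/-- Parameters whose zeros have distinct nonzero norms larger than `1`. -/
structure Param.IsSeparated (c : Param p) : Prop where
  one_lt : ∀ i, 1 ≤ i → 1 < ‖c i‖
  norm_ne : ∀ i j, 1 ≤ i → 1 ≤ j → i ≠ j → ‖c i‖ ≠ ‖c j‖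

theorem Param.IsSeparated.ne_zero {c : Param p} (h : c.IsSeparated) {i : ℕ} (hi : 1 ≤ i) :
    c i ≠ 0 := norm_pos_iff.1 (one_pos.trans (h.one_lt i hi))

section
variable {K : Type*} [NormedCommRing K] [NormMulClass K] [NormOneClass K] [NormedAlgebra ℂ_[p] K]
  [IsUltrametricDist K]

theorem Param.IsSeparated.offZeros_erase {c : Param p} (h : c.IsSeparated) {j : ℕ} (hj : 1 ≤ j)
    {y : K} (hy : ‖y‖ = ‖c j‖) : OffZeros (c.erase j) y := by
  intro i hi
  refine norm_factor_of_ne ?_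
  rcases eq_or_ne i j with rfl | hij
  · exact Or.inr (c.erase_self i)
  · rw [hy, c.erase_of_ne hij]
    exact Or.inl (h.norm_ne j i hj hi hij.symm)

end

variable {c : Param p} {j : ℕ}

/-- On `D(c_j, |c_j|)` the map `f_c` multiplies distances by `Φ_c(|c_j|) / |c_j|`. -/
theorem Param.IsSeparated.norm_entireMap_sub (h : c.IsSeparated) (hj : 1 ≤ j) {z w : ℂ_[p]}
    (hz : ‖z - c j‖ < ‖c j‖) (hw : ‖w - c j‖ < ‖c j‖) :
    ‖entireMap c z - entireMap c w‖ = gauge c ‖c j‖ / ‖c j‖ * ‖z - w‖ := by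
  have h0 := h.ne_zero hj
  have hR : 0 < ‖c j‖ := norm_pos_iff.2 h0
  have hwn : ‖w‖ = ‖c j‖ := norm_eq_of_mem_disk (K := ℂ_[p]) hw
  have hzn : ‖z‖ = ‖c j‖ := norm_eq_of_mem_disk (K := ℂ_[p]) hz
  have hoff := h.offZeros_erase hj hwn
  have hzw : ‖z - w‖ ≤ ‖c j‖ := by
    have := IsUltrametricDist.norm_add_le_max (z - c j) (-(w - c j))
    rw [norm_neg, show z - c j + -(w - c j) = z - w by ring] at this
    exact this.trans (max_le hz.le hw.le)
  have hq := hoff.norm_evalMap_sub_le (CloseParams.refl _) (y' := z) (e := ‖z - w‖ / ‖c j‖)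
    (by positivity) (div_le_one_of_le₀ hzw hR.le) (by rw [hwn, div_mul_cancel₀ _ hR.ne'])
    (by rw [mul_zero]; positivity)
  have hqw : ‖evalMap (c.erase j) w‖ = gauge c ‖c j‖ := by
    rw [hoff.norm_evalMap, hwn, gauge_erase_norm c hj h0]
  have hqz : ‖evalMap (c.erase j) z‖ = gauge c ‖c j‖ := by
    rw [(h.offZeros_erase hj hzn).norm_evalMap, hzn, gauge_erase_norm c hj h0]
  have hG := gauge_pos c hR
  rcases eq_or_ne z w with rfl | hne
  · simp
  have hzw0 : 0 < ‖z - w‖ := norm_pos_iff.2 (sub_ne_zero.2 hne)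
  have hsplit : entireMap c z - entireMap c w =
      (evalMap (c.erase j) z - evalMap (c.erase j) w) * factor c j w +
      evalMap (c.erase j) z * -(algebraMap ℂ_[p] ℂ_[p] (c j)⁻¹ * (z - w)) := by
    rw [← evalMap_eq_entireMap, ← evalMap_eq_entireMap, evalMap_eq_erase_mul c hj,
      evalMap_eq_erase_mul c hj w, factor, factor]
    ring
  have h2 : ‖evalMap (c.erase j) z * -(algebraMap ℂ_[p] ℂ_[p] (c j)⁻¹ * (z - w))‖ =
      gauge c ‖c j‖ / ‖c j‖ * ‖z - w‖ := by
    rw [norm_mul, norm_neg, norm_algebraMap_inv_mul, hqz]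
    ring
  have hu : ‖factor c j w‖ < 1 := by
    rw [norm_factor_eq_div h0, div_lt_one hR]
    exact hw
  have h1 : ‖(evalMap (c.erase j) z - evalMap (c.erase j) w) * factor c j w‖ <
      gauge c ‖c j‖ / ‖c j‖ * ‖z - w‖ := by
    rw [norm_mul]
    calc _ ≤ ‖z - w‖ / ‖c j‖ * gauge c ‖c j‖ * ‖factor c j w‖ := by
          rw [hqw] at hq
          gcongr
      _ < ‖z - w‖ / ‖c j‖ * gauge c ‖c j‖ * 1 := by gcongr
      _ = _ := by ring
  rw [hsplit, IsUltrametricDist.norm_add_eq_max_of_norm_ne_norm (by rw [h2]; exact h1.ne), h2,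
    max_eq_right h1.le]

/-- The fixed point is that of the contraction `z ↦ c_j - c_j z / q(z)`, where
`f_c(z) = q(z) (1 - z / c_j)`. -/
theorem Param.IsSeparated.exists_fixedPt (h : c.IsSeparated) (hj : 1 ≤ j) :
    ∃ w, ‖w - c j‖ < ‖c j‖ ∧ entireMap c w = w := by
  have h0 := h.ne_zero hj
  have hR : 0 < ‖c j‖ := norm_pos_iff.2 h0
  have hG := lt_gauge c (h.one_lt j hj).le
  have hG0 := gauge_pos c hR
  set G := gauge c ‖c j‖ with hGdef
  set r := ‖c j‖ * ‖c j‖ / G with hr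
  have hrR : r < ‖c j‖ := by
    rw [hr, div_lt_iff₀ hG0]
    gcongr
  set q : ℂ_[p] → ℂ_[p] := fun z => evalMap (c.erase j) z with hqdef
  set T : ℂ_[p] → ℂ_[p] := fun z => c j - c j * z / q z with hT
  set s := Metric.closedBall (c j) r with hs
  have hnorm : ∀ z ∈ s, ‖z‖ = ‖c j‖ := fun z hz =>
    norm_eq_of_mem_disk (K := ℂ_[p]) ((mem_closedBall_iff_norm.1 hz).trans_lt hrR)
  have hq : ∀ z ∈ s, ‖q z‖ = G := fun z hz => by
    rw [hqdef]
    dsimp only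
    rw [(h.offZeros_erase hj (hnorm z hz)).norm_evalMap, hnorm z hz, gauge_erase_norm c hj h0]
  have hmaps : Set.MapsTo T s s := by
    intro z hz
    rw [hs, mem_closedBall_iff_norm, hT]
    dsimp only
    rw [sub_sub_cancel_left, norm_neg, norm_div, norm_mul, hnorm z hz, hq z hz]
  have hr0 : 0 < r := by positivity
  have hcontr : ContractingWith (Real.toNNReal (‖c j‖ / G)) (Set.MapsTo.restrict T s s hmaps) := by
    refine ⟨by rw [Real.toNNReal_lt_one, div_lt_one hG0]; exact hG, ?_⟩
    refine LipschitzWith.of_dist_le_mul fun z w => ?_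
    obtain ⟨z, hz⟩ := z
    obtain ⟨w, hw⟩ := w
    rw [Subtype.dist_eq, Subtype.dist_eq, Real.coe_toNNReal _ (by positivity), dist_eq_norm,
      dist_eq_norm]
    change ‖T z - T w‖ ≤ ‖c j‖ / G * ‖z - w‖
    have hqz : q z ≠ 0 := norm_pos_iff.1 (by rw [hq z hz]; exact hG0)
    have hqw : q w ≠ 0 := norm_pos_iff.1 (by rw [hq w hw]; exact hG0)
    have hzw : ‖z - w‖ ≤ ‖c j‖ := by
      have := IsUltrametricDist.norm_add_le_max (z - c j) (-(w - c j))
      rw [norm_neg, show z - c j + -(w - c j) = z - w by ring] at this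
      exact this.trans (max_le ((mem_closedBall_iff_norm.1 hz).trans hrR.le)
        ((mem_closedBall_iff_norm.1 hw).trans hrR.le))
    have hqs : ‖q z - q w‖ ≤ ‖z - w‖ / ‖c j‖ * G := by
      have := (h.offZeros_erase hj (hnorm w hw)).norm_evalMap_sub_le (CloseParams.refl _)
        (y' := z) (e := ‖z - w‖ / ‖c j‖) (by positivity) (div_le_one_of_le₀ hzw hR.le)
        (by rw [hnorm w hw, div_mul_cancel₀ _ hR.ne']) (by rw [mul_zero]; positivity)
      rwa [show ‖evalMap (c.erase j) w‖ = G from hq w hw] at this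
    have hid : T z - T w = c j * (w * (q z - q w) - (z - w) * q w) / (q z * q w) := by
      rw [hT]
      field_simp
      ring
    have hnum : ‖w * (q z - q w) - (z - w) * q w‖ ≤ ‖z - w‖ * G := by
      rw [sub_eq_add_neg]
      refine (IsUltrametricDist.norm_add_le_max _ _).trans (max_le ?_ ?_)
      · rw [norm_mul, hnorm w hw]
        calc ‖c j‖ * ‖q z - q w‖ ≤ ‖c j‖ * (‖z - w‖ / ‖c j‖ * G) := by gcongr
          _ = _ := by field_simp
      · rw [norm_neg, norm_mul, hq w hw]
    rw [hid, norm_div, norm_mul, norm_mul, hq z hz, hq w hw]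
    calc _ ≤ ‖c j‖ * (‖z - w‖ * G) / (G * G) := by gcongr
      _ = _ := by field_simp
  obtain ⟨w, hws, hw, -⟩ := ContractingWith.exists_fixedPoint'
    (Metric.isClosed_closedBall.isComplete) hmaps hcontr (x := c j)
    (Metric.mem_closedBall_self hr0.le) (edist_ne_top _ _)
  refine ⟨w, (mem_closedBall_iff_norm.1 hws).trans_lt hrR, ?_⟩
  have hqw : q w ≠ 0 := norm_pos_iff.1 (by rw [hq w hws]; exact hG0)
  have hw' : c j - c j * w / q w = w := hw
  rw [← evalMap_eq_entireMap, evalMap_eq_erase_mul c hj]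
  change q w * (1 - (c j)⁻¹ * w) = w
  field_simp at hw' ⊢
  linear_combination hw'

/-- `|λ_j| = Φ_c(|c_j|) / |c_j|`. -/
theorem Param.IsSeparated.norm_multiplier (h : c.IsSeparated) (hj : 1 ≤ j) :
    ‖multiplier c j‖ = gauge c ‖c j‖ / ‖c j‖ := by
  obtain ⟨hw, hfix⟩ := Classical.epsilon_spec (h.exists_fixedPt hj)
  change ‖fixedPt c j - c j‖ < ‖c j‖ at hw
  change entireMap c (fixedPt c j) = fixedPt c j at hfix
  have hR : 0 < ‖c j‖ := norm_pos_iff.2 (h.ne_zero hj)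
  have hwn : ‖fixedPt c j‖ = ‖c j‖ := norm_eq_of_mem_disk (K := ℂ_[p]) hw
  refine norm_deriv_eq_of_dilation hR (differentiableAt_entireMap c (fun i hi => h.ne_zero hi) ?_)
    fun z hz => ?_
  · rw [hfix]
    exact norm_pos_iff.1 (by rwa [hwn])
  · refine h.norm_entireMap_sub hj ?_ hw
    have := IsUltrametricDist.norm_add_le_max (z - fixedPt c j) (fixedPt c j - c j)
    rw [sub_add_sub_cancel] at this
    exact this.trans_lt (max_lt hz hw)

end

section

variable {p : ℕ} [hp : Fact p.Prime]

/-! ### The constant `ϱ` -/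

theorem rho_pos : 0 < rho p := Real.rpow_pos_of_pos prime_pos_real _

theorem rho_lt_one : rho p < 1 := by
  have h1 := one_lt_prime_real (p := p)
  exact Real.rpow_lt_one_of_one_lt_of_neg h1 (div_neg_of_neg_of_pos (by norm_num) (by linarith))

theorem rho_pow_pred : rho p ^ (p - 1) = (p : ℝ)⁻¹ := by
  have h1 := one_lt_prime_real (p := p)
  have h2 : ((p : ℝ) - 1) ≠ 0 := by linarith
  rw [rho, ← Real.rpow_natCast, ← Real.rpow_mul prime_pos_real.le, Nat.cast_sub hp.out.one_le,
    Nat.cast_one, div_mul_cancel₀ _ h2, Real.rpow_neg_one]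

/-- Up to `ϱ`, raising to the `p`-th power contracts at least as much as dividing by `p`. -/
theorem pow_prime_le_div {e : ℝ} (he0 : 0 ≤ e) (he : e ≤ rho p) : e ^ p ≤ e / p := by
  obtain ⟨q, hq⟩ : ∃ q, p = q + 1 := ⟨p - 1, by have := hp.out.pos; omega⟩
  have h1 : e ^ (p - 1) ≤ (p : ℝ)⁻¹ := by
    rw [← rho_pow_pred]
    exact pow_le_pow_left₀ he0 he _
  have h2 : e ^ p = e ^ (p - 1) * e := by
    rw [← pow_succ, Nat.sub_add_cancel hp.out.one_le]
  rw [h2, div_eq_inv_mul]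
  gcongr

/-! ### Orbits of the gauge -/

/-- Parameters with generic radii `|c_1| < |c_2| < …`. -/
structure Param.IsGeneric (c : Param p) : Prop where
  prime_lt : ∀ i, 1 ≤ i → (p : ℝ) < ‖c i‖
  norm_lt : ∀ i j, 1 ≤ i → i < j → ‖c i‖ < ‖c j‖
  iterate_ne : ∀ i j n, 1 ≤ i → i < j → 1 ≤ n → (gauge c)^[n] ‖c i‖ ≠ ‖c j‖

theorem Param.IsGeneric.one_lt {c : Param p} (h : c.IsGeneric) {i : ℕ} (hi : 1 ≤ i) : 1 < ‖c i‖ :=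
  one_lt_prime_real.trans (h.prime_lt i hi)

theorem Param.IsGeneric.isSeparated {c : Param p} (h : c.IsGeneric) : c.IsSeparated where
  one_lt _ hi := h.one_lt hi
  norm_ne i j hi hj hij := by
    rcases lt_or_gt_of_ne hij with h1 | h1
    · exact (h.norm_lt i j hi h1).ne
    · exact (h.norm_lt j i hj h1).ne'

theorem gauge_injOn (c : Param p) : Set.InjOn (gauge c) (Set.Ioi 0) := fun s hs t ht hst => by
  rcases lt_trichotomy s t with h | h | h
  · exact absurd hst (gauge_lt_gauge c hs h).ne
  · exact h
  · exact absurd hst (gauge_lt_gauge c ht h).ne'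

theorem le_gauge_iterate (c : Param p) {t : ℝ} (ht : 1 ≤ t) (n : ℕ) : t ≤ (gauge c)^[n] t := by
  induction n generalizing t with
  | zero => exact le_rfl
  | succ n ih =>
    have h := (lt_gauge c ht).le
    rw [Function.iterate_succ_apply]
    exact h.trans (ih (ht.trans h))

/-- Genericity: a radius that the gauge sends to `|c_j|` differs from all radii. -/
theorem Param.IsGeneric.ne_norm {c : Param p} (h : c.IsGeneric) {t : ℝ} {n j : ℕ} (hj : 1 ≤ j)
    (ht : 1 ≤ t) (hn : (gauge c)^[n + 1] t = ‖c j‖) {i : ℕ} (hi : 1 ≤ i) : t ≠ ‖c i‖ := by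
  rintro rfl
  rcases lt_or_ge i j with hij | hij
  · exact h.iterate_ne i j (n + 1) hi hij (by omega) hn
  · have h1 := lt_gauge c ht
    have h2 := le_gauge_iterate c (ht.trans h1.le) n
    rw [← Function.iterate_succ_apply, hn] at h2
    rcases hij.eq_or_lt with rfl | hji
    · linarith
    · linarith [h.norm_lt j i hj hji]

theorem gauge_of_le_one {c : Param p} (hc : ∀ i, 1 ≤ i → (p : ℝ) < ‖c i‖) {t : ℝ} (ht : t ≤ 1) :
    gauge c t = p * t ^ p := by
  rw [gauge_eq_of_forall (N := 0) fun i _ => ?_, Finset.prod_range_zero, mul_one]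
  have h := one_lt_prime_real.trans (hc (i + 1) (Nat.le_add_left 1 i))
  exact div_le_one_of_le₀ (ht.trans h.le) (norm_nonneg _)

/-! ### Cylinders -/

theorem mem_cylinder_cons {c : Param p} {a : Letter} {α : List Letter} {x : BerkovichLine p} :
    x ∈ cylinder c (a :: α) ↔ x ∈ region c a ∧ berkovichMap c x ∈ cylinder c α := by
  constructor
  · intro h
    refine ⟨h 0 (by simp), fun n hn => ?_⟩
    have := h (n + 1) (by simpa using hn)
    rwa [Function.iterate_succ_apply] at this
  · rintro ⟨h1, h2⟩ n hn
    cases n with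
    | zero => exact h1
    | succ n =>
      rw [Function.iterate_succ_apply]
      exact h2 n (by simpa using hn)

variable {K : Type*} [NormedCommRing K] [NormMulClass K] [NormOneClass K] [NormedAlgebra ℂ_[p] K]

theorem pointOf_mem_regionB_zero {c : Param p} {y : K} :
    pointOf p y ∈ regionB c 0 ↔ ‖y‖ < 1 := by
  rw [regionB, if_pos rfl, pointOf_mem_disk, map_zero, sub_zero]

theorem pointOf_mem_regionB {c : Param p} {j : ℕ} (hj : 1 ≤ j) {y : K} :
    pointOf p y ∈ regionB c j ↔ ‖y - algebraMap ℂ_[p] K (c j)‖ < ‖c j‖ := by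
  rw [regionB, if_neg (by omega), pointOf_mem_disk]

theorem pointOf_mem_region_A {c : Param p} {y : K} : pointOf p y ∈ region c Letter.A ↔
    1 ≤ ‖y‖ ∧ ∀ j, 1 ≤ j → ‖c j‖ ≤ ‖y - algebraMap ℂ_[p] K (c j)‖ := by
  rw [region, Set.mem_compl_iff, Set.mem_iUnion, not_exists]
  constructor
  · intro h
    exact ⟨not_lt.1 fun h1 => h 0 (pointOf_mem_regionB_zero.2 h1),
      fun j hj => not_lt.1 fun h1 => h j ((pointOf_mem_regionB hj).2 h1)⟩
  · rintro ⟨h1, h2⟩ j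
    rcases Nat.eq_zero_or_pos j with rfl | hj
    · rw [pointOf_mem_regionB_zero]
      exact not_lt.2 h1
    · rw [pointOf_mem_regionB hj]
      exact not_lt.2 (h2 j hj)

variable [CompleteSpace K]

theorem pointOf_mem_cylinder_cons {c : Param p} {a : Letter} {α : List Letter} {y : K} :
    pointOf p y ∈ cylinder c (a :: α) ↔
      pointOf p y ∈ region c a ∧ pointOf p (evalMap c y) ∈ cylinder c α := by
  rw [mem_cylinder_cons, berkovichMap_pointOf]

variable [IsUltrametricDist K]

theorem offZeros_of_mem_region_A {c : Param p} {y : K} (hy : pointOf p y ∈ region c Letter.A) :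
    OffZeros c y := by
  intro i hi
  rcases eq_or_ne (c i) 0 with h0 | h0
  · exact norm_factor_of_ne (Or.inr h0)
  rcases eq_or_ne ‖y‖ ‖c i‖ with h | h
  · have hR := norm_pos_iff.2 h0
    refine le_antisymm (norm_factor_le c i y) ?_
    rw [h, div_self hR.ne', max_self, norm_factor_eq_div h0, one_le_div hR]
    exact (pointOf_mem_region_A.1 hy).2 i hi
  · exact norm_factor_of_ne (Or.inl h)

theorem norm_sub_algebraMap_of_ne {a : ℂ_[p]} {y : K} (h : ‖y‖ ≠ ‖a‖) :
    ‖y - algebraMap ℂ_[p] K a‖ = max ‖y‖ ‖a‖ := by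
  rw [sub_eq_add_neg, IsUltrametricDist.norm_add_eq_max_of_norm_ne_norm, norm_neg,
    norm_algebraMap']
  rwa [norm_neg, norm_algebraMap']

/-- While an orbit stays in `A`, its norms follow the gauge. -/
theorem gauge_iterate_of_mem_cylinder {c : Param p} {j : ℕ} (hj : 1 ≤ j) {β : List Letter} (n : ℕ)
    {y : K} (hy : pointOf p y ∈ cylinder c (List.replicate n Letter.A ++ Letter.B j :: β)) :
    (gauge c)^[n] ‖y‖ = ‖c j‖ := by
  induction n generalizing y with
  | zero =>
    rw [List.replicate_zero, List.nil_append, pointOf_mem_cylinder_cons] at hy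
    exact norm_eq_of_mem_disk ((pointOf_mem_regionB hj).1 hy.1)
  | succ n ih =>
    rw [List.replicate_succ, List.cons_append, pointOf_mem_cylinder_cons] at hy
    rw [Function.iterate_succ_apply, ← (offZeros_of_mem_region_A hy.1).norm_evalMap]
    exact ih hy.2

/-- An error bound `e < 1` relative to the orbit survives the passage through `A`, where `S` is
the radius `S_j` of the last point of the orbit in `A`. -/
theorem mem_cylinder_A {c c' : Param p} {E : ℝ} (hc : c.IsGeneric) (hcc : CloseParams c c' E)
    (hreg : region c = region c') {j : ℕ} (hj : 1 ≤ j) {β : List Letter} {S e : ℝ} (hS : 0 < S)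
    (hSj : gauge c S = ‖c j‖) (he0 : 0 ≤ e) (he : e < 1) (hSE : S * E ≤ e)
    (hcont : ∀ z z' : K, pointOf p z ∈ cylinder c (Letter.B j :: β) → ‖z' - z‖ ≤ e * ‖z‖ →
      pointOf p z' ∈ cylinder c' (Letter.B j :: β)) (n : ℕ) {y y' : K}
    (hy : pointOf p y ∈ cylinder c (List.replicate n Letter.A ++ Letter.B j :: β))
    (h : ‖y' - y‖ ≤ e * ‖y‖) :
    pointOf p y' ∈ cylinder c' (List.replicate n Letter.A ++ Letter.B j :: β) := by
  induction n generalizing y y' with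
  | zero => exact hcont y y' hy h
  | succ n ih =>
    have hg := gauge_iterate_of_mem_cylinder hj (n + 1) hy
    rw [List.replicate_succ, List.cons_append, pointOf_mem_cylinder_cons] at hy ⊢
    have hA := pointOf_mem_region_A.1 hy.1
    have hy0 : 0 < ‖y‖ := one_pos.trans_le hA.1
    have hyn : ‖y'‖ = ‖y‖ := norm_eq_of_norm_sub_lt (h.trans_lt (mul_lt_of_lt_one_left hy0 he))
    have hyS : ‖y‖ ≤ S := by
      have h1 := le_gauge_iterate c hA.1 n
      rw [Function.iterate_succ_apply', ← hSj] at hg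
      rwa [gauge_injOn c (hy0.trans_le h1) hS hg] at h1
    constructor
    · rw [← hreg]
      refine pointOf_mem_region_A.2 ⟨hA.1.trans_eq hyn.symm, fun i hi => ?_⟩
      rw [norm_sub_algebraMap_of_ne (hyn.trans_ne (hc.ne_norm hj hA.1 hg hi))]
      exact le_max_right _ _
    · refine ih hy.2 ((offZeros_of_mem_region_A hy.1).norm_evalMap_sub_le hcc he0 he.le h ?_)
      exact (mul_le_mul_of_nonneg_right hyS hcc.nonneg).trans hSE

theorem norm_evalMap_of_norm_lt_one {c : Param p} (hc : c.IsGeneric) {y : K} (hy : ‖y‖ < 1) :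
    ‖evalMap c y‖ = p * ‖y‖ ^ p := by
  have hoff : OffZeros c y := fun i hi =>
    norm_factor_of_ne (Or.inl (hy.trans (hc.one_lt hi)).ne)
  rw [hoff.norm_evalMap, gauge_of_le_one hc.prime_lt hy.le]

/-- A point of `B_0` whose orbit leaves `B_0` has norm larger than `ϱ`. -/
theorem rho_lt_norm_of_mem_cylinder {c : Param p} (hc : c.IsGeneric) {β : List Letter}
    (hβ : ∀ z : K, pointOf p z ∈ cylinder c β → 1 ≤ ‖z‖) (m : ℕ) {y : K}
    (hy : pointOf p y ∈ cylinder c (List.replicate m (Letter.B 0) ++ β)) : rho p < ‖y‖ := by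
  induction m generalizing y with
  | zero => exact rho_lt_one.trans_le (hβ y hy)
  | succ m ih =>
    rw [List.replicate_succ, List.cons_append, pointOf_mem_cylinder_cons] at hy
    have h1 := ih hy.2
    rw [norm_evalMap_of_norm_lt_one hc (pointOf_mem_regionB_zero.1 hy.1)] at h1
    by_contra! hle
    have h2 := pow_prime_le_div (norm_nonneg y) hle
    rw [le_div_iff₀' prime_pos_real] at h2
    linarith

/-- Relative errors during the stay in `B_0`: those created by the perturbation are at most `κ`,
and the initial one is multiplied by at most `θ` at each step. -/
theorem mem_cylinder_B_zero {c c' : Param p} {E : ℝ} (hc : c.IsGeneric)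
    (hcc : CloseParams c c' E) {β : List Letter} {κ θ M : ℝ}
    (hEκ : E ≤ κ) (hκM : κ ≤ M) (hM : M < 1) (hθ0 : 0 ≤ θ) (hθ1 : θ ≤ 1)
    (hθ : ∀ e, 0 ≤ e → e ≤ M → max (e / p) (e ^ p) ≤ θ * e) (m : ℕ) {e : ℝ} (he0 : 0 ≤ e)
    (he : e ≤ M)
    (hcont : ∀ z z' : K, pointOf p z ∈ cylinder c β → ‖z' - z‖ ≤ max (e * θ ^ m) κ * ‖z‖ →
      pointOf p z' ∈ cylinder c' β) {y y' : K}
    (hy : pointOf p y ∈ cylinder c (List.replicate m (Letter.B 0) ++ β))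
    (h : ‖y' - y‖ ≤ e * ‖y‖) :
    pointOf p y' ∈ cylinder c' (List.replicate m (Letter.B 0) ++ β) := by
  have hκ0 : 0 ≤ κ := hcc.nonneg.trans hEκ
  induction m generalizing y y' e with
  | zero =>
    refine hcont y y' hy (h.trans ?_)
    gcongr
    simp
  | succ m ih =>
    rw [List.replicate_succ, List.cons_append, pointOf_mem_cylinder_cons] at hy ⊢
    have hy1 : ‖y‖ < 1 := pointOf_mem_regionB_zero.1 hy.1
    have hle := norm_le_of_norm_sub_le_mul (he.trans hM.le) h
    refine ⟨pointOf_mem_regionB_zero.2 (hle.trans_lt hy1), ?_⟩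
    have hstep := norm_evalMap_sub_le_of_norm_lt_one hcc (fun i hi => (hc.prime_lt i hi).le) hy1
      he0 (he.trans hM.le) (hκM.trans hM.le) h
      ((mul_le_of_le_one_left hcc.nonneg hy1.le).trans hEκ)
    refine ih (e := max (θ * e) κ) (le_max_of_le_right hκ0)
      (max_le ((mul_le_of_le_one_left he0 hθ1).trans he) hκM) (fun z z' hz hzz => ?_) hy.2 ?_
    · refine hcont z z' hz (hzz.trans ?_)
      refine mul_le_mul_of_nonneg_right ?_ (norm_nonneg _)
      rw [max_mul_of_nonneg _ _ (pow_nonneg hθ0 m)]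
      refine max_le (max_le ((le_of_eq (by ring)).trans (le_max_left _ _)) ?_) (le_max_right _ _)
      exact (mul_le_of_le_one_right hκ0 (pow_le_one₀ hθ0 hθ1)).trans (le_max_right _ _)
    · refine hstep.trans ?_
      gcongr
      exact hθ e he0 he

/-- An orbit cannot go from `B_0` to `B_j` directly. -/
theorem not_mem_cylinder_B_zero_B {c : Param p} (hc : c.IsGeneric) {j : ℕ} (hj : 1 ≤ j)
    {β : List Letter} (m : ℕ) {y : K} :
    pointOf p y ∉ cylinder c (List.replicate (m + 1) (Letter.B 0) ++ Letter.B j :: β) := by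
  induction m generalizing y with
  | zero =>
    intro hy
    rw [List.replicate_succ, List.cons_append, pointOf_mem_cylinder_cons, List.replicate_zero,
      List.nil_append, pointOf_mem_cylinder_cons] at hy
    obtain ⟨h1, h2, -⟩ := hy
    have h1' : ‖y‖ < 1 := pointOf_mem_regionB_zero.1 h1
    have h3 := norm_eq_of_mem_disk ((pointOf_mem_regionB hj).1 h2)
    rw [norm_evalMap_of_norm_lt_one hc h1'] at h3
    have h4 := hc.prime_lt j hj
    have h5 : (p : ℝ) * ‖y‖ ^ p ≤ p :=
      mul_le_of_le_one_right prime_pos_real.le (pow_le_one₀ (norm_nonneg _) h1'.le)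
    linarith
  | succ m ih =>
    intro hy
    rw [List.replicate_succ, List.cons_append, pointOf_mem_cylinder_cons] at hy
    exact ih hy.2

theorem one_le_norm_of_mem_cylinder {c : Param p} (hc : c.IsGeneric) {j : ℕ} (hj : 1 ≤ j)
    {β : List Letter} (n : ℕ) {y : K}
    (hy : pointOf p y ∈ cylinder c (List.replicate n Letter.A ++ Letter.B j :: β)) : 1 ≤ ‖y‖ := by
  cases n with
  | zero =>
    rw [List.replicate_zero, List.nil_append, pointOf_mem_cylinder_cons] at hy
    rw [norm_eq_of_mem_disk ((pointOf_mem_regionB hj).1 hy.1)]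
    exact (hc.one_lt hj).le
  | succ n =>
    rw [List.replicate_succ, List.cons_append, pointOf_mem_cylinder_cons] at hy
    exact (pointOf_mem_region_A.1 hy.1).1

/-- A nonempty cylinder `B_0^{m+1} A^n B_j …` yields the radius `S_j`, that of the last point in
`A`. -/
theorem exists_gauge_eq_of_mem_cylinder {c : Param p} (hc : c.IsGeneric) {j : ℕ} (hj : 1 ≤ j)
    {β : List Letter} {m n : ℕ} (hm : 0 < m) {y : K}
    (hy : pointOf p y ∈ cylinder c
      (List.replicate m (Letter.B 0) ++ (List.replicate n Letter.A ++ Letter.B j :: β))) :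
    ∃ S, 1 ≤ S ∧ gauge c S = ‖c j‖ := by
  cases n with
  | zero =>
    obtain ⟨m, rfl⟩ : ∃ k, m = k + 1 := ⟨m - 1, by omega⟩
    exact absurd hy (not_mem_cylinder_B_zero_B hc hj m)
  | succ n =>
    clear hm
    induction m generalizing y with
    | zero =>
      have h1 := one_le_norm_of_mem_cylinder hc hj (n + 1) hy
      have h2 := gauge_iterate_of_mem_cylinder hj (n + 1) hy
      rw [Function.iterate_succ_apply'] at h2
      exact ⟨_, h1.trans (le_gauge_iterate c h1 n), h2⟩
    | succ m ih =>
      rw [List.replicate_succ, List.cons_append, pointOf_mem_cylinder_cons] at hy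
      exact ih hy.2

/-- Relative errors along `B_0^m A^n`. -/
theorem mem_cylinder_excursion {c c' : Param p} {E : ℝ} (hc : c.IsGeneric)
    (hcc : CloseParams c c' E) (hreg : region c = region c') {j : ℕ} (hj : 1 ≤ j)
    {β : List Letter} {S θ M e : ℝ} (hS : 1 ≤ S) (hSj : gauge c S = ‖c j‖) (hSM : S * E ≤ M)
    (hM : M < 1) (hθ0 : 0 ≤ θ) (hθ1 : θ ≤ 1)
    (hθ : ∀ e, 0 ≤ e → e ≤ M → max (e / p) (e ^ p) ≤ θ * e) {m n : ℕ} (he0 : 0 ≤ e) (he : e ≤ M)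
    (hcont : ∀ z z' : K, pointOf p z ∈ cylinder c (Letter.B j :: β) →
      ‖z' - z‖ ≤ max (e * θ ^ m) (S * E) * ‖z‖ → pointOf p z' ∈ cylinder c' (Letter.B j :: β))
    {y y' : K}
    (hy : pointOf p y ∈ cylinder c
      (List.replicate m (Letter.B 0) ++ (List.replicate n Letter.A ++ Letter.B j :: β)))
    (h : ‖y' - y‖ ≤ e * ‖y‖) :
    pointOf p y' ∈ cylinder c'
      (List.replicate m (Letter.B 0) ++ (List.replicate n Letter.A ++ Letter.B j :: β)) := by
  refine mem_cylinder_B_zero hc hcc (κ := S * E) (le_mul_of_one_le_left hcc.nonneg hS) hSM hM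
    hθ0 hθ1 hθ m he0 he (fun z z' hz hzz => ?_) hy h
  refine mem_cylinder_A hc hcc hreg hj (one_pos.trans_le hS) hSj ?_ ?_ (le_max_right _ _) hcont n
    hz hzz
  · exact le_max_of_le_left (by positivity)
  · exact (max_le ((mul_le_of_le_one_right he0 (pow_le_one₀ hθ0 hθ1)).trans he) hSM).trans_lt hM

/-- Along `B_j^ℓ` distances grow by at most the factor `(Φ_c(|c_j|) / |c_j|)^ℓ`. -/
theorem mem_cylinder_B {c c' : Param p} {E : ℝ} (hc : c.IsGeneric)
    (hcc : CloseParams c c' E) (hreg : region c = region c') {j : ℕ} (hj : 1 ≤ j)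
    (hjj : c' j = c j) (hRE : ‖c j‖ * E ≤ 1) {β : List Letter} (ℓ : ℕ) {δ : ℝ} (hδ0 : 0 ≤ δ)
    (hδ : (gauge c ‖c j‖ / ‖c j‖) ^ ℓ * δ < ‖c j‖)
    (hinj : ‖c j‖ * E * ‖c j‖ ≤ gauge c ‖c j‖ / ‖c j‖ * δ)
    (hβ : ∀ z : K, pointOf p z ∈ cylinder c β → ‖z‖ ≤ ‖c j‖)
    (hcont : ∀ z z' : K, pointOf p z ∈ cylinder c β →
      ‖z' - z‖ ≤ (gauge c ‖c j‖ / ‖c j‖) ^ ℓ * δ → pointOf p z' ∈ cylinder c' β) {y y' : K}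
    (hy : pointOf p y ∈ cylinder c (List.replicate ℓ (Letter.B j) ++ β)) (h : ‖y' - y‖ ≤ δ) :
    pointOf p y' ∈ cylinder c' (List.replicate ℓ (Letter.B j) ++ β) := by
  have hR : 0 < ‖c j‖ := one_pos.trans (hc.one_lt hj)
  have hΛ : 1 ≤ gauge c ‖c j‖ / ‖c j‖ := (one_le_div hR).2 (lt_gauge c (hc.one_lt hj).le).le
  set Λ := gauge c ‖c j‖ / ‖c j‖ with hΛdef
  have hle : ∀ (k : ℕ) (z : K), pointOf p z ∈ cylinder c (List.replicate k (Letter.B j) ++ β) →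
      ‖z‖ ≤ ‖c j‖ := by
    intro k z hz
    cases k with
    | zero => exact hβ z hz
    | succ k =>
      rw [List.replicate_succ, List.cons_append, pointOf_mem_cylinder_cons] at hz
      exact (norm_eq_of_mem_disk ((pointOf_mem_regionB hj).1 hz.1)).le
  induction ℓ generalizing y y' δ with
  | zero => exact hcont y y' hy (by simpa using h)
  | succ ℓ ih =>
    rw [List.replicate_succ, List.cons_append, pointOf_mem_cylinder_cons] at hy ⊢
    have hyd := (pointOf_mem_regionB hj).1 hy.1
    have hδR : δ < ‖c j‖ := (le_mul_of_one_le_left hδ0 (one_le_pow₀ hΛ)).trans_lt hδ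
    have hδΛ : δ ≤ Λ * δ := le_mul_of_one_le_left hδ0 hΛ
    constructor
    · rw [← hreg]
      refine (pointOf_mem_regionB hj).2 ?_
      have := IsUltrametricDist.norm_add_le_max (y' - y) (y - algebraMap ℂ_[p] K (c j))
      rw [sub_add_sub_cancel] at this
      exact this.trans_lt (max_lt (h.trans_lt hδR) hyd)
    · have hstep := norm_evalMap_sub_le_of_mem_disk hcc hj (hc.isSeparated.ne_zero hj) hjj hyd
        (hc.isSeparated.offZeros_erase hj (norm_eq_of_mem_disk hyd)) h hδR.le hRE
      have hE := hcc.nonneg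
      refine ih (δ := Λ * δ) (by positivity) hy.2 (hstep.trans (max_le le_rfl ?_)) ?_ ?_ ?_
      · refine le_trans ?_ hinj
        have := hle ℓ _ hy.2
        gcongr
      · rwa [← mul_assoc, ← pow_succ]
      · exact hinj.trans (mul_le_mul_of_nonneg_left hδΛ (zero_le_one.trans hΛ))
      · intro z z' hz hzz
        rw [← mul_assoc, ← pow_succ] at hzz
        exact hcont z z' hz hzz

end

section

variable {p : ℕ} [hp : Fact p.Prime]

/-! ### The words `α^{(k)}` -/

/-- The part of `α^{(j + d)}` that begins with the excursion `B_0^{m_j} A^{n_j}`. -/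
def tailWord (n m ℓ : ℕ → ℕ) (j d : ℕ) : List Letter :=
  (List.range' j d).flatMap
      (fun i => excursion n m i ++ List.replicate (ℓ (i + 1)) (Letter.B i))
    ++ excursion n m (j + d) ++ [Letter.B (j + d)]

theorem tailWord_one (n m ℓ : ℕ → ℕ) {k : ℕ} (hk : 1 ≤ k) :
    tailWord n m ℓ 1 (k - 1) = truncation n m ℓ k := by
  rw [tailWord, truncation, Nat.add_sub_cancel' hk]

theorem tailWord_zero (n m ℓ : ℕ → ℕ) (j : ℕ) :
    tailWord n m ℓ j 0 =
      List.replicate (m j) (Letter.B 0) ++ (List.replicate (n j) Letter.A ++ [Letter.B j]) := by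
  simp [tailWord, excursion]

theorem tailWord_succ (n m ℓ : ℕ → ℕ) (j d : ℕ) :
    tailWord n m ℓ j (d + 1) = List.replicate (m j) (Letter.B 0) ++
      (List.replicate (n j) Letter.A ++
        (List.replicate (ℓ (j + 1)) (Letter.B j) ++ tailWord n m ℓ (j + 1) d)) := by
  simp [tailWord, excursion, List.range'_succ, Nat.add_right_comm, Nat.add_assoc]

theorem exists_tailWord_eq_cons (n m ℓ : ℕ → ℕ) (j d : ℕ) (hm : 0 < m j) :
    ∃ β, tailWord n m ℓ j d = Letter.B 0 :: β := by
  obtain ⟨k, hk⟩ : ∃ k, m j = k + 1 := ⟨m j - 1, by omega⟩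
  cases d with
  | zero => exact ⟨_, by rw [tailWord_zero, hk, List.replicate_succ, List.cons_append]⟩
  | succ d => exact ⟨_, by rw [tailWord_succ, hk, List.replicate_succ, List.cons_append]⟩

/-! ### Propagation of the error along `α^{(k)}` -/

variable {K : Type*} [NormedCommRing K] [NormMulClass K] [NormOneClass K] [NormedAlgebra ℂ_[p] K]
  [CompleteSpace K] [IsUltrametricDist K]

/-- The inductive step of the stability of cylinders. Let `T_j` be the radius `S_j` whenever it
exists, and `L_j = R_{j-1} S_{j-1} |λ_{j-1}| ^ ℓ_j`. The distance `δ` of the two orbits on entering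
the `j`-th excursion is at most `ϱ ^ (k - j + 1)`, and at most `L_j E` if `j ≥ 2`, whence
`δ p ^ (-m_j) ≤ ϱ² E`. -/
theorem mem_cylinder_tailWord {c c' : Param p} {E : ℝ} (hc : c.IsGeneric)
    (hcc : CloseParams c c' E) (hreg : region c = region c') {n m ℓ : ℕ → ℕ} {k : ℕ}
    (hm : ∀ j, 1 ≤ j → 0 < m j) (hℓ : ∀ j, 2 ≤ j → 0 < ℓ j) (hEk : ‖c k‖ * E ≤ 1)
    (hjj : ∀ j, 1 ≤ j → j < k → c' j = c j) {T : ℕ → ℝ}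
    (hT : ∀ j S, 1 ≤ j → 0 < S → gauge c S = ‖c j‖ → T j = S)
    (hstab : ∀ j, 1 ≤ j → j < k → 1 ≤ T j →
      (gauge c ‖c j‖ / ‖c j‖) ^ ℓ (j + 1) * (‖c j‖ * (T j * E)) ≤ rho p ^ (k - j))
    (htrans : ∀ j, 1 ≤ j → j < k → 1 ≤ T j →
      (gauge c ‖c j‖ / ‖c j‖) ^ ℓ (j + 1) * (‖c j‖ * T j) ≤ rho p ^ 2 * (p : ℝ) ^ m (j + 1))
    (d : ℕ) {j : ℕ} (hj : 1 ≤ j) (hjd : j + d = k) {δ : ℝ} (hδ0 : 0 ≤ δ)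
    (hδ : δ ≤ rho p ^ (d + 1)) (hδm : δ ≤ rho p ^ 2 * E * (p : ℝ) ^ m j) {y y' : K}
    (hy : pointOf p y ∈ cylinder c (tailWord n m ℓ j d)) (h : ‖y' - y‖ ≤ δ) :
    pointOf p y' ∈ cylinder c' (tailWord n m ℓ j d) := by
  have hρ0 := rho_pos (p := p)
  have hρ1 := rho_lt_one (p := p)
  have hp1 := one_lt_prime_real (p := p)
  have hp0 := prime_pos_real (p := p)
  have hE := hcc.nonneg
  induction d generalizing j y y' δ with
  | zero =>
    obtain rfl : j = k := hjd
    rw [tailWord_zero] at hy ⊢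
    obtain ⟨S, hS, hSj⟩ := exists_gauge_eq_of_mem_cylinder hc hj (hm j hj) hy
    have hyρ := rho_lt_norm_of_mem_cylinder hc
      (fun z hz => one_le_norm_of_mem_cylinder hc hj _ hz) _ hy
    have hy0 : 0 < ‖y‖ := hρ0.trans hyρ
    have he1 : δ / ‖y‖ < 1 := by
      rw [div_lt_one hy0]
      exact (hδ.trans_eq (by ring)).trans_lt hyρ
    have hSE : S * E < 1 := by
      rcases hE.eq_or_lt with h0 | h0
      · rw [← h0, mul_zero]
        exact one_pos
      · exact (mul_lt_mul_of_pos_right ((lt_gauge c hS).trans_eq hSj) h0).trans_le hEk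
    refine mem_cylinder_excursion hc hcc hreg hj hS hSj (θ := 1)
      (M := max (δ / ‖y‖) (S * E)) (e := δ / ‖y‖) (le_max_right _ _) (max_lt he1 hSE) zero_le_one
      le_rfl (fun e he0 he => ?_) (by positivity) (le_max_left _ _) (fun z z' hz hzz => ?_) hy
      (by rwa [div_mul_cancel₀ _ hy0.ne'])
    · rw [one_mul]
      exact max_le (div_le_self he0 hp1.le)
        (pow_le_of_le_one he0 (he.trans (max_lt he1 hSE).le) hp.out.ne_zero)
    · rw [pointOf_mem_cylinder_cons] at hz ⊢
      refine ⟨?_, fun i hi => by simp at hi⟩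
      have hzd := (pointOf_mem_regionB hj).1 hz.1
      have hzn := norm_eq_of_mem_disk hzd
      rw [← hreg]
      refine (pointOf_mem_regionB hj).2 ?_
      have h1 := IsUltrametricDist.norm_add_le_max (z' - z) (z - algebraMap ℂ_[p] K (c j))
      rw [sub_add_sub_cancel] at h1
      refine h1.trans_lt (max_lt (hzz.trans_lt ?_) hzd)
      rw [one_pow, mul_one, hzn]
      exact mul_lt_of_lt_one_left (one_pos.trans (hc.one_lt hj)) (max_lt he1 hSE)
  | succ d ih =>
    have hjk : j < k := by omega
    obtain ⟨l, hl⟩ : ∃ l, ℓ (j + 1) = l + 1 :=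
      ⟨ℓ (j + 1) - 1, by have := hℓ (j + 1) (by omega); omega⟩
    have hR := hc.one_lt hj
    have hR0 : 0 < ‖c j‖ := one_pos.trans hR
    rw [tailWord_succ, hl, List.replicate_succ, List.cons_append] at hy ⊢
    obtain ⟨S, hS, hSj⟩ := exists_gauge_eq_of_mem_cylinder hc hj (hm j hj) hy
    have hyρ := rho_lt_norm_of_mem_cylinder hc
      (fun z hz => one_le_norm_of_mem_cylinder hc hj _ hz) _ hy
    have hTS := hT j S hj (one_pos.trans_le hS) hSj
    have hstab' := hstab j hj hjk (hS.trans_eq hTS.symm)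
    have htrans' := htrans j hj hjk (hS.trans_eq hTS.symm)
    rw [hTS] at hstab' htrans'
    have hkj : k - j = d + 1 := by omega
    rw [hkj] at hstab'
    have hΛ : 1 ≤ gauge c ‖c j‖ / ‖c j‖ := (one_le_div hR0).2 (lt_gauge c hR.le).le
    set Λ := gauge c ‖c j‖ / ‖c j‖ with hΛdef
    have hSE0 : 0 ≤ S * E := by positivity
    have hδρ : δ / rho p ≤ rho p := by
      rw [div_le_iff₀ hρ0]
      refine hδ.trans ?_
      rw [← sq]
      exact pow_le_pow_of_le_one hρ0.le hρ1.le (by omega)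
    have hpowρ : rho p ^ (d + 1) ≤ rho p := pow_le_of_le_one hρ0.le hρ1.le (by omega)
    have hSEρ : S * E ≤ rho p := by
      refine le_trans ?_ (hstab'.trans hpowρ)
      refine (le_mul_of_one_le_left hSE0 hR.le).trans ?_
      exact le_mul_of_one_le_left (by positivity) (one_le_pow₀ hΛ)
    have hlast : max (δ / rho p * (1 / p) ^ m j) (S * E) = S * E := by
      refine max_eq_right ?_
      have h1 : δ / rho p * (1 / p) ^ m j = δ / (rho p * (p : ℝ) ^ m j) := by
        rw [div_pow, one_pow]
        field_simp
      rw [h1, div_le_iff₀ (by positivity)]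
      calc δ ≤ rho p * (rho p * E * (p : ℝ) ^ m j) := hδm.trans_eq (by ring)
        _ ≤ S * (rho p * E * (p : ℝ) ^ m j) := by
            gcongr
            exact hρ1.le.trans hS
        _ = _ := by ring
    refine mem_cylinder_excursion hc hcc hreg hj hS hSj (θ := 1 / p) (M := rho p)
      (e := δ / rho p) hSEρ hρ1 (by positivity) ((div_le_one hp0).2 hp1.le)
      (fun e he0 he => ?_) (by positivity) hδρ (fun z z' hz hzz => ?_) hy ?_
    · rw [one_div_mul_eq_div]
      exact max_le le_rfl (pow_prime_le_div he0 he)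
    · have hzn := norm_eq_of_mem_disk
        ((pointOf_mem_regionB hj).1 (pointOf_mem_cylinder_cons.1 hz).1)
      rw [← List.cons_append, ← List.replicate_succ, ← hl] at hz ⊢
      rw [hlast, hzn, mul_comm] at hzz
      refine mem_cylinder_B hc hcc hreg hj (hjj j hj hjk) ?_ _ (by positivity)
        ((hstab'.trans hpowρ).trans_lt (hρ1.trans hR)) ?_ (fun w hw => ?_)
        (fun w w' hw hww => ?_) hz hzz
      · exact (mul_le_mul_of_nonneg_right (hc.norm_lt j k hj hjk).le hE).trans hEk
      · -- `R_j ≤ Λ S_j`, as `Φ(t) / t` is nondecreasing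
        have h1 := gauge_mul_le_gauge_mul c (one_pos.trans_le hS) ((lt_gauge c hS).trans_eq hSj).le
        rw [hSj] at h1
        calc ‖c j‖ * E * ‖c j‖ = ‖c j‖ * ‖c j‖ * E := by ring
          _ ≤ gauge c ‖c j‖ * S * E := by gcongr
          _ = Λ * (‖c j‖ * (S * E)) := by rw [hΛdef]; field_simp
      · obtain ⟨β, hβ⟩ := exists_tailWord_eq_cons n m ℓ (j + 1) d (hm (j + 1) (by omega))
        rw [hβ, pointOf_mem_cylinder_cons] at hw
        exact (pointOf_mem_regionB_zero.1 hw.1).le.trans hR.le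
      · refine ih (by omega) (by omega) (δ := Λ ^ ℓ (j + 1) * (‖c j‖ * (S * E))) (by positivity)
          hstab' ?_ hw hww
        calc Λ ^ ℓ (j + 1) * (‖c j‖ * (S * E)) = Λ ^ ℓ (j + 1) * (‖c j‖ * S) * E := by ring
          _ ≤ rho p ^ 2 * (p : ℝ) ^ m (j + 1) * E := by gcongr
          _ = _ := by ring
    · refine h.trans ?_
      calc δ = δ / rho p * rho p := (div_mul_cancel₀ _ hρ0.ne').symm
        _ ≤ δ / rho p * ‖y‖ := by gcongr

end

section

variable {p : ℕ} [hp : Fact p.Prime]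

/-! ### Parameters in `𝒞(r)` and their perturbations -/

theorem IsGenericRadii.isGeneric {R : ℕ → ℝ} (hR : IsGenericRadii p R) {c : Param p}
    (hc : c ∈ paramSpace p R) : c.IsGeneric := by
  have hlt : ∀ i, 1 ≤ i → (p : ℝ) < ‖c i‖ := by
    intro i hi
    rw [hc i hi]
    rcases hi.eq_or_lt with rfl | h
    · exact hR.lt_first
    · exact hR.lt_first.trans (hR.increasing 1 i le_rfl h)
  refine ⟨hlt, fun i j hi hij => ?_, fun i j n hi hij hn => ?_⟩
  · rw [hc i hi, hc j (hi.trans hij.le)]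
    exact hR.increasing i j hi hij
  · have h := hR.generic c hc i j n hi hij hn
    rw [← hc i hi, ← hc j (hi.trans hij.le)] at h
    rwa [← phi_iterate_eq_gauge c n (prime_pos_real.trans (hlt i hi))]

theorem perturbations_symm {k : ℕ} {c c' : Param p} {ε : ℕ → ℝ}
    (h : c' ∈ perturbations k c ε) : c ∈ perturbations k c' ε :=
  ⟨fun j hj hjk => (h.1 j hj hjk).symm, fun j hj hjk => by
    rw [norm_sub_rev]
    exact h.2 j hj hjk⟩

theorem norm_sub_lt_of_mem_perturbations {R : ℕ → ℝ} {k : ℕ} {c c' : Param p} {ε : ℕ → ℝ}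
    (hR : ∀ j, 1 ≤ j → 0 < R j) (hε : ∀ j, 1 ≤ j → 0 < ε j ∧ ε j < R j)
    (h : c' ∈ perturbations k c ε) {j : ℕ} (hj : 1 ≤ j) : ‖c' j - c j‖ < R j := by
  rcases lt_or_ge j k with hjk | hjk
  · rw [h.1 j hj hjk, sub_self, norm_zero]
    exact hR j hj
  · rw [norm_sub_rev]
    exact (h.2 j hj hjk).trans (hε j hj).2

theorem mem_paramSpace_of_mem_perturbations {R : ℕ → ℝ} {k : ℕ} {c c' : Param p} {ε : ℕ → ℝ}
    (hR : ∀ j, 1 ≤ j → 0 < R j) (hε : ∀ j, 1 ≤ j → 0 < ε j ∧ ε j < R j)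
    (hc : c ∈ paramSpace p R) (h : c' ∈ perturbations k c ε) : c' ∈ paramSpace p R := by
  intro j hj
  rw [← hc j hj]
  refine norm_eq_of_norm_sub_lt ?_
  rw [hc j hj]
  exact norm_sub_lt_of_mem_perturbations hR hε h hj

theorem disk_subset_disk {a b : ℂ_[p]} {r : ℝ} (h : ‖a - b‖ < r) :
    BerkovichLine.disk a r ⊆ BerkovichLine.disk b r := by
  intro x hx
  change x (X - C b) < r
  have h1 : (X - C b : ℂ_[p][X]) = (X - C a) + C (a - b) := by rw [C_sub]; ring
  rw [h1]
  refine (x.add_le_max _ _).trans_lt (max_lt hx ?_)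
  rwa [x.map_C]

/-- Close parameters define the same partition of the Berkovich line. -/
theorem region_eq_of_norm_sub_lt {c c' : Param p} (hn : ∀ j, 1 ≤ j → ‖c' j‖ = ‖c j‖)
    (h : ∀ j, 1 ≤ j → ‖c' j - c j‖ < ‖c j‖) : region c = region c' := by
  have hB : ∀ j, regionB c j = regionB c' j := by
    intro j
    rcases Nat.eq_zero_or_pos j with rfl | hj
    · rw [regionB, regionB, if_pos rfl, if_pos rfl]
    · rw [regionB, regionB, if_neg (by omega), if_neg (by omega), hn j hj]
      refine Set.Subset.antisymm (disk_subset_disk ?_) (disk_subset_disk (h j hj))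
      rw [norm_sub_rev]
      exact h j hj
  funext L
  cases L with
  | A => simp only [region, hB]
  | B j => exact hB j

theorem norm_inv_sub_inv {a b : ℂ_[p]} {r : ℝ} (hr : 0 < r) (ha : ‖a‖ = r) (hb : ‖b‖ = r) :
    ‖b⁻¹ - a⁻¹‖ = ‖a - b‖ / r ^ 2 := by
  have ha0 : a ≠ 0 := norm_pos_iff.1 (hr.trans_eq ha.symm)
  have hb0 : b ≠ 0 := norm_pos_iff.1 (hr.trans_eq hb.symm)
  rw [inv_sub_inv hb0 ha0, norm_div, norm_mul, ha, hb, sq]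

theorem cylinder_subset_of_mem_perturbations {R : ℕ → ℝ} (hR : IsGenericRadii p R) {n m ℓ : ℕ → ℕ}
    (hm : ∀ j, 1 ≤ j → 0 < m j) (hℓ : ∀ j, 2 ≤ j → 0 < ℓ j) {ε : ℕ → ℝ}
    (hε : ∀ j, 1 ≤ j → 0 < ε j ∧ ε j < R j) {b : Param p} (hb : b ∈ paramSpace p R)
    {k : ℕ} (hk : 1 ≤ k)
    (stability : ∀ i, k < i → ∀ j, 2 ≤ j → j < i →
      ε i < rho p ^ (i - j) * (R i ^ 2 / (R (j - 1) * invRadius b (j - 1)))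
        * ‖multiplier b (j - 1)‖ ^ (-(ℓ j : ℤ)))
    (transversality : ∀ j, 2 ≤ j → j ≤ k →
      rho p ^ (-2 : ℤ) * R (j - 1) * invRadius b (j - 1)
        * ‖multiplier b (j - 1)‖ ^ (ℓ j) * (p : ℝ) ^ (-(m j : ℤ)) < 1)
    {c c' : Param p} (hc : c ∈ paramSpace p R) (hc' : c' ∈ perturbations (k + 1) c ε) :
    cylinder c (truncation n m ℓ k) ⊆ cylinder c' (truncation n m ℓ k) := by
  have hcg := hR.isGeneric hc
  have hρ0 := rho_pos (p := p)
  have hp0 := prime_pos_real (p := p)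
  have hR1 : ∀ j, 1 ≤ j → 1 < R j := fun j hj => by
    rw [← hc j hj]
    exact hcg.one_lt hj
  have hR0 : ∀ j, 1 ≤ j → 0 < R j := fun j hj => one_pos.trans (hR1 j hj)
  have hcp := mem_paramSpace_of_mem_perturbations hR0 hε hc hc'
  have hnorm : ∀ j, 1 ≤ j → ‖c' j‖ = ‖c j‖ := fun j hj => by rw [hc j hj, hcp j hj]
  have hreg : region c = region c' := region_eq_of_norm_sub_lt hnorm fun j hj => by
    rw [hc j hj]
    exact norm_sub_lt_of_mem_perturbations hR0 hε hc' hj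
  have hgauge : ∀ t, gauge b t = gauge c t :=
    gauge_congr fun i hi => by rw [hb i hi, hc i hi]
  have hmult : ∀ j, 1 ≤ j → ‖multiplier b j‖ = gauge c ‖c j‖ / ‖c j‖ := fun j hj => by
    rw [(hR.isGeneric hb).isSeparated.norm_multiplier hj, hgauge, hb j hj, hc j hj]
  -- the supremum of the perturbations of the inverses `1 / c_i`, for `i > k`
  set E : ℝ := ⨆ i : ℕ, ε (k + 1 + i) / R (k + 1 + i) ^ 2 with hE
  have hεR : ∀ i, ε (k + 1 + i) / R (k + 1 + i) ^ 2 ≤ 1 / R k := by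
    intro i
    have h1 := hR0 (k + 1 + i) (by omega)
    have h2 := hR0 k hk
    have h3 := hR.increasing k (k + 1 + i) hk (by omega)
    have h4 := (hε (k + 1 + i) (by omega)).2.le
    rw [div_le_div_iff₀ (by positivity) h2, one_mul, sq]
    exact mul_le_mul h4 h3.le h2.le h1.le
  have hbdd : BddAbove (Set.range fun i : ℕ => ε (k + 1 + i) / R (k + 1 + i) ^ 2) := by
    refine ⟨1 / R k, ?_⟩
    rintro _ ⟨i, rfl⟩
    exact hεR i
  have hE0 : 0 ≤ E := by
    refine le_trans ?_ (le_ciSup hbdd 0)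
    have := (hε (k + 1 + 0) (by omega)).1
    positivity
  have hcc : CloseParams c c' E := by
    refine ⟨hnorm, fun i hi => ?_⟩
    rcases lt_or_ge i (k + 1) with h | h
    · rw [hc'.1 i hi h, sub_self, norm_zero]
      exact hE0
    · obtain ⟨d, rfl⟩ := Nat.exists_eq_add_of_le h
      rw [norm_inv_sub_inv (hR0 _ hi) (hc _ hi) (hcp _ hi)]
      refine le_trans ?_ (le_ciSup hbdd d)
      have := (hc'.2 _ hi h).le
      gcongr
  intro x hx
  rw [← tailWord_one n m ℓ hk, ← pointOf_coord x] at hx ⊢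
  refine mem_cylinder_tailWord hcg hcc hreg hm hℓ (k := k) (T := invRadius b) ?_
    (fun j hj hjk => (hc'.1 j hj (by omega)).symm) (fun j S hj hS hSj => ?_) (fun j hj hjk hT => ?_)
    (fun j hj hjk hT => ?_) (k - 1) le_rfl (by omega) (δ := 0) le_rfl (by positivity)
    (by positivity) hx (by simp)
  · rw [hc k hk, ← le_div_iff₀' (hR0 k hk)]
    exact ciSup_le hεR
  · exact invRadius_eq b hS (by rw [hgauge, hSj, hb j hj, hc j hj])
  · have hΛ : 0 < gauge c ‖c j‖ / ‖c j‖ := by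
      have h1 : 0 < ‖c j‖ := one_pos.trans (hcg.one_lt hj)
      exact div_pos (gauge_pos c h1) h1
    have hT0 : 0 < invRadius b j := one_pos.trans_le hT
    have hRj := hR0 j hj
    have hpos : 0 < (gauge c ‖c j‖ / ‖c j‖) ^ ℓ (j + 1) * (R j * invRadius b j) := by positivity
    have hEle : E ≤ rho p ^ (k - j) /
        ((gauge c ‖c j‖ / ‖c j‖) ^ ℓ (j + 1) * (R j * invRadius b j)) := by
      refine ciSup_le fun i => ?_
      have h1 := stability (k + 1 + i) (by omega) (j + 1) (by omega) (by omega)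
      rw [Nat.add_sub_cancel, hmult j hj, zpow_neg, zpow_natCast] at h1
      have hRi := hR0 (k + 1 + i) (by omega)
      rw [div_le_iff₀ (by positivity)]
      refine h1.le.trans ?_
      have h2 : rho p ^ (k + 1 + i - (j + 1)) ≤ rho p ^ (k - j) :=
        pow_le_pow_of_le_one hρ0.le rho_lt_one.le (by omega)
      calc _ ≤ rho p ^ (k - j) * (R (k + 1 + i) ^ 2 / (R j * invRadius b j)) *
            ((gauge c ‖c j‖ / ‖c j‖) ^ ℓ (j + 1))⁻¹ := by gcongr
        _ = _ := by field_simp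
    rw [le_div_iff₀ hpos] at hEle
    rw [hc j hj] at hEle ⊢
    linarith
  · have h1 := transversality (j + 1) (by omega) (by omega)
    rw [Nat.add_sub_cancel, hmult j hj, zpow_neg, zpow_neg, zpow_natCast] at h1
    have h2 : (rho p ^ (2 : ℤ)) = rho p ^ 2 := by norm_cast
    rw [h2, ← div_eq_mul_inv, div_lt_one (by positivity), mul_assoc, mul_assoc,
      inv_mul_lt_iff₀ (by positivity)] at h1
    rw [hc j hj] at h1 ⊢
    linarith

end

end CylStab

end

open CylStab in
theorem lemmal (p : ℕ) [Fact p.Prime]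
    (R : ℕ → ℝ) (hR : IsGenericRadii p R)
    (m ℓ : ℕ → ℕ) (hm : ∀ j, 1 ≤ j → 0 < m j) (hℓ : ∀ j, 2 ≤ j → 0 < ℓ j)
    (ε : ℕ → ℝ) (hε : ∀ j, 1 ≤ j → 0 < ε j ∧ ε j < R j)
    (b : Param p) (hb : b ∈ paramSpace p R)
    (k₀ : ℕ) (hk₀ : 1 ≤ k₀)
    (stability : ∀ k, k₀ < k → ∀ j, 2 ≤ j → j < k →
      ε k < rho p ^ (k - j) * (R k ^ 2 / (R (j - 1) * invRadius b (j - 1)))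
        * ‖multiplier b (j - 1)‖ ^ (-(ℓ j : ℤ)))
    (transversality : ∀ j, 2 ≤ j → j ≤ k₀ →
      rho p ^ (-2 : ℤ) * R (j - 1) * invRadius b (j - 1)
        * ‖multiplier b (j - 1)‖ ^ (ℓ j) * (p : ℝ) ^ (-(m j : ℤ)) < 1)
    (c : Param p) (hc : c ∈ paramSpace p R)
    (c' : Param p) (hc' : c' ∈ perturbations (k₀ + 1) c ε) :
    cylinder c' (truncation (transitTime b) m ℓ k₀) =
      cylinder c (truncation (transitTime b) m ℓ k₀) := by
  have hR0 : ∀ j, 1 ≤ j → 0 < R j := fun j hj => (hε j hj).1.trans (hε j hj).2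
  have hcp := mem_paramSpace_of_mem_perturbations hR0 hε hc hc'
  exact Set.Subset.antisymm
    (cylinder_subset_of_mem_perturbations hR hm hℓ hε hb hk₀ stability transversality hcp
      (perturbations_symm hc'))
    (cylinder_subset_of_mem_perturbations hR hm hℓ hε hb hk₀ stability transversality hc hc')
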